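/- Let $O_{A_{\mathbb N}}$ be the universal $C^*$-algebra generated by a sequence $\{s_i : i=0,1,2,\dots\}$ of partial isometries subject to the relations $$s_i^*s_j=0\quad (i\neq j),\qquad s_i^*s_i=\sum_{k=0}^{i}s_ks_k^*\quad (i\ge 0),$$ and let $J\subset O_{A_{\mathbb N}}$ be the closed two-sided ideal generated by $s_0-s_0s_0^*$. Let $\mathcal F$ be the weakly monotone Fock space over $\ell^2(\{1,2,\dots\})$, i.e. the Hilbert space with orthonormal basis the vectors $e_{i_1}\otimes\cdots\otimes e_{i_k}$ with $k\ge 0$ and $i_1\ge i_2\ge\cdots\ge i_k\ge 1$ (for $k=0$ this is the vacuum vector $\Omega$). For $i\ge 1$ let $A_i^\dagger\in\mathcal B(\mathcal F)$ be the creator given by $A_i^\dagger\Omega=e_i$ and, for $k\ge1$, $A_i^\dagger(e_{i_1}\otimes\cdots\otimes e_{i_k})=e_i\otimes e_{i_1}\otimes\cdots\otimes e_{i_k}$ if $i\ge i_1$ and $0$ otherwise, let $A_i=(A_i^\dagger)^*$, let $P_\Omega$ be the orthogonal projection onto $\mathbb C\Omega$, and let $\mathcal W_{\mathbb N}\subset\mathcal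 B(\mathcal F)$ be the (not necessarily unital) $C^*$-algebra generated by $\{A_i,A_i^\dagger : i\ge 1\}$. Then: 1. There is a representation $\pi_F: O_{A_{\mathbb N}}\to\mathcal B(\mathcal F)$ (the Fock representation) with $\pi_F(s_0)=P_\Omega$ and $\pi_F(s_i)=A_i^\dagger$ for $i\ge1$, and it induces an isometric $*$-isomorphism $O_{A_{\mathbb N}}/J\to\mathcal W_{\mathbb N}$, $[x]\mapsto\pi_F(x)$, where the quotient carries the quotient norm. 2. $\mathcal W_{\mathbb N}$ is isomorphic to the universal $C^*$-algebra generated by a sequence of partial isometries $\{s_i: i\ge 0\}$ satisfying the above relations together with $s_0=s_0s_0^*$, via $s_0\mapsto P_\Omega$ and $s_i\mapsto A_i^\dagger$ for $i\ge1$. That is, $P_\Omega\in\mathcal W_{\mathbb N}$, the family $(P_\Omega,A_1^\dagger,A_2^\dagger,\dots)$ satisfies these relations, and for every sequence $(t_i)_{i\ge0}$ of partial isometries in a $C^*$-algebra $B$ satisfying them there is a unique $*$-homomorphism $\varphi:\mathcal W_{\mathbb N}\to B$ with $\varphi(P_\Omega)=t_0$ and $\varphi(A_i^\dagger)=t_i$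 for $i\ge1$. -/

import Mathlib

universe u v

noncomputable section

open scoped ENNReal

namespace WeaklyMonotone

/-! ### Relations -/

/-- A family `t 0, t 1, …` in a C⋆-algebra consists of partial isometries and satisfies
`tᵢ* tⱼ = 0` for `i ≠ j` and `tᵢ* tᵢ = ∑_{k ≤ i} tₖ tₖ*` for all `i`. -/
structure MonotoneRel {B : Type v} [NonUnitalCStarAlgebra B] (t : ℕ → B) : Prop where
  partialIsometry : ∀ i, t i * star (t i) * t i = t i
  orthogonal : ∀ i j, i ≠ j → star (t i) * t j = 0
  sum_range : ∀ i, star (t i) * t i = ∑ k ∈ Finset.range (i + 1), t k * star (t k)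

/-- The relations of `MonotoneRel` together with `t₀ = t₀ t₀*`. -/
structure VacuumRel {B : Type v} [NonUnitalCStarAlgebra B] (t : ℕ → B) : Prop
    extends MonotoneRel t where
  vacuum : t 0 = t 0 * star (t 0)

lemma norm_le_one_of_partialIsometry {B : Type v} [NonUnitalCStarAlgebra B] {x : B}
    (hx : x * star x * x = x) : ‖x‖ ≤ 1 := by
  have h2 : star x * x * (star x * x) = star x * x := by
    rw [mul_assoc, ← mul_assoc x, hx]
  have h3 : ‖star x * x‖ * ‖star x * x‖ = ‖star x * x‖ := by
    have := CStarRing.norm_star_mul_self (x := star x * x)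
    rw [star_mul, star_star, h2] at this
    exact this.symm
  have h4 : ‖star x * x‖ = ‖x‖ * ‖x‖ := CStarRing.norm_star_mul_self
  by_contra! h
  have h5 : 1 < ‖star x * x‖ := by rw [h4]; nlinarith
  nlinarith

/-! ### Universal C⋆-algebras generated by partial isometries -/

/-- A sequence of partial isometries satisfying the relations `P`, in some C⋆-algebra. -/
structure Model (P : ∀ (B : Type u) [NonUnitalCStarAlgebra B], (ℕ → B) → Prop) where
  /-- the C⋆-algebra -/
  alg : Type u
  /-- its structure -/
  [inst : NonUnitalCStarAlgebra alg]
  /-- the family -/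
  gen : ℕ → alg
  partialIsometry : ∀ i, gen i * star (gen i) * gen i = gen i
  rel : P alg gen

attribute [instance] Model.inst

variable (P : ∀ (B : Type u) [NonUnitalCStarAlgebra B], (ℕ → B) → Prop)

/-- The ℓ^∞-product of all models, a C⋆-algebra. -/
abbrev ModelProduct : Type (u + 1) := lp (fun r : Model P => r.alg) ∞

/-- The family in the product of all models whose component in each model is its given family. -/
def productGen (i : ℕ) : ModelProduct P :=
  ⟨fun r => r.gen i, memℓp_infty ⟨1, by
    rintro _ ⟨r, rfl⟩
    exact norm_le_one_of_partialIsometry (r.partialIsometry i)⟩⟩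

/-- The universal C⋆-algebra generated by a sequence of partial isometries subject to the
relations `P`: the C⋆-subalgebra generated by the canonical family in the product of all models.
Thus the norm of a ⋆-polynomial in the generators is the supremum of its norms in all models. -/
def universalSubalgebra : NonUnitalStarSubalgebra ℂ (ModelProduct P) :=
  (NonUnitalStarAlgebra.adjoin ℂ (Set.range (productGen P))).topologicalClosure

instance : IsClosed (universalSubalgebra P : Set (ModelProduct P)) :=
  NonUnitalStarSubalgebra.isClosed_topologicalClosure _

/-- The universal C⋆-algebra, as a type. -/
def UniversalCStar : Type (u + 1) := universalSubalgebra P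

instance : NonUnitalCStarAlgebra (UniversalCStar P) :=
  inferInstanceAs (NonUnitalCStarAlgebra (universalSubalgebra P))

/-- The canonical generators of the universal C⋆-algebra. -/
def universalGen (i : ℕ) : UniversalCStar P :=
  ⟨productGen P i, NonUnitalStarSubalgebra.le_topologicalClosure _
    (NonUnitalStarAlgebra.subset_adjoin ℂ _ ⟨i, rfl⟩)⟩

/-- Projection of the universal C⋆-algebra to a model. -/
def evalModel (r : Model P) : UniversalCStar P →⋆ₙₐ[ℂ] r.alg where
  toFun x := x.1 r
  map_smul' _ _ := rfl
  map_zero' := rfl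
  map_add' _ _ := rfl
  map_mul' _ _ := rfl
  map_star' _ := rfl

/-- ⋆-homomorphisms on a generated C⋆-subalgebra that agree on the generators are equal. -/
lemma hom_ext_of_generates {C : Type v} [NonUnitalCStarAlgebra C] {B : Type u}
    [NonUnitalCStarAlgebra B] (X : Set C) (S : NonUnitalStarSubalgebra ℂ C)
    (hS : S = (NonUnitalStarAlgebra.adjoin ℂ X).topologicalClosure)
    [hc : IsClosed (S : Set C)] (ψ φ : S →⋆ₙₐ[ℂ] B)
    (h : ∀ x (hx : x ∈ S), x ∈ X → ψ ⟨x, hx⟩ = φ ⟨x, hx⟩) : ψ = φ := by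
  have hle : NonUnitalStarAlgebra.adjoin ℂ X ≤ S :=
    hS ▸ NonUnitalStarSubalgebra.le_topologicalClosure _
  have key : ∀ (x : C) (_ : x ∈ NonUnitalStarAlgebra.adjoin ℂ X) (hx' : x ∈ S),
      ψ ⟨x, hx'⟩ = φ ⟨x, hx'⟩ := by
    intro x hx
    induction hx using NonUnitalStarAlgebra.adjoin_induction with
    | mem x hx => exact fun hx' => h x hx' hx
    | add x y hx hy ihx ihy =>
      intro _
      have : ψ _ + ψ _ = φ _ + φ _ := congrArg₂ (· + ·) (ihx (hle hx)) (ihy (hle hy))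
      rw [← map_add, ← map_add] at this; exact this
    | zero => intro _; exact (map_zero ψ).trans (map_zero φ).symm
    | mul x y hx hy ihx ihy =>
      intro _
      have : ψ _ * ψ _ = φ _ * φ _ := congrArg₂ (· * ·) (ihx (hle hx)) (ihy (hle hy))
      rw [← map_mul, ← map_mul] at this; exact this
    | smul c x hx ihx =>
      intro _
      have : c • ψ _ = c • φ _ := congrArg (c • ·) (ihx (hle hx))
      rw [← map_smul, ← map_smul] at this; exact this
    | star x hx ihx =>
      intro _
      have : star (ψ _) = star (φ _) := congrArg star (ihx (hle hx))
      rw [← map_star, ← map_star] at this; exact this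
  have hd : Dense {x : S | x.1 ∈ NonUnitalStarAlgebra.adjoin ℂ X} := by
    intro x
    rw [closure_subtype]
    have hx : x.1 ∈ closure (NonUnitalStarAlgebra.adjoin ℂ X : Set C) := by
      have h1 : S ≤ (NonUnitalStarAlgebra.adjoin ℂ X).topologicalClosure := hS.le
      exact h1 x.2
    refine closure_mono ?_ hx
    intro y hy
    exact ⟨⟨y, hle hy⟩, hy, rfl⟩
  have hcont : ∀ χ : S →⋆ₙₐ[ℂ] B, Continuous χ := fun χ =>
    AddMonoidHomClass.continuous_of_bound χ 1 fun x => by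
      simpa using NonUnitalStarAlgHom.norm_apply_le χ x
  exact DFunLike.coe_injective
    (Continuous.ext_on hd (hcont ψ) (hcont φ) fun x hx => key x.1 hx x.2)

/-- The universal property: every family of partial isometries satisfying the relations is
the image of the canonical generators under a unique ⋆-homomorphism. -/
theorem existsUnique_lift {B : Type u} [NonUnitalCStarAlgebra B] (t : ℕ → B)
    (hpi : ∀ i, t i * star (t i) * t i = t i) (ht : P B t) :
    ∃! φ : UniversalCStar P →⋆ₙₐ[ℂ] B, ∀ i, φ (universalGen P i) = t i := by
  refine ⟨evalModel P ⟨B, t, hpi, ht⟩, fun i => rfl, fun ψ hψ => ?_⟩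
  refine hom_ext_of_generates (Set.range (productGen P)) (universalSubalgebra P) rfl ψ
    (evalModel P ⟨B, t, hpi, ht⟩) ?_
  rintro _ _ ⟨i, rfl⟩
  exact hψ i

/-! ### The two universal algebras -/

/-- `O_{A_ℕ}`: the universal C⋆-algebra generated by partial isometries `s₀, s₁, …` with
`sᵢ* sⱼ = 0` for `i ≠ j` and `sᵢ* sᵢ = ∑_{k ≤ i} sₖ sₖ*`. -/
abbrev OAN : Type (u + 1) := UniversalCStar.{u} fun _ _ t => MonotoneRel t

/-- The generators of `O_{A_ℕ}`. -/
def OAN.s (i : ℕ) : OAN.{u} := universalGen.{u} _ i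

/-- The universal C⋆-algebra generated by partial isometries satisfying the relations of
`O_{A_ℕ}` and `s₀ = s₀ s₀*`. -/
abbrev VacuumOAN : Type (u + 1) := UniversalCStar.{u} fun _ _ t => VacuumRel t

/-- Its generators. -/
def VacuumOAN.s (i : ℕ) : VacuumOAN.{u} := universalGen.{u} _ i

lemma productGen_rel (hP : ∀ (B : Type u) [NonUnitalCStarAlgebra B] (t : ℕ → B), P B t →
    MonotoneRel t) : MonotoneRel (universalGen P) where
  partialIsometry i := by
    apply Subtype.ext; apply Subtype.ext; funext r
    exact r.partialIsometry i
  orthogonal i j hij := by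
    apply Subtype.ext; apply Subtype.ext; funext r
    exact (hP _ _ r.rel).orthogonal i j hij
  sum_range i := by
    apply Subtype.ext; apply Subtype.ext; funext r
    have h := (hP _ _ r.rel).sum_range i
    have h2 : ((∑ k ∈ Finset.range (i + 1), universalGen P k * star (universalGen P k) :
        UniversalCStar P).1 r : r.alg) = ∑ k ∈ Finset.range (i + 1), r.gen k * star (r.gen k) :=
      map_sum (evalModel P r) _ _
    exact h.trans h2.symm

theorem OAN.rel : MonotoneRel OAN.s.{u} := productGen_rel _ fun _ _ _ h => h

theorem VacuumOAN.rel : VacuumRel VacuumOAN.s.{u} where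
  toMonotoneRel := productGen_rel _ fun _ _ _ h => h.toMonotoneRel
  vacuum := by
    apply Subtype.ext; apply Subtype.ext; funext r
    exact r.rel.vacuum

/-! ### Closed ideals and quotients -/

section Quotient

variable {A : Type v} [NonUnitalCStarAlgebra A]

/-- A norm-closed two-sided ideal. -/
structure IsClosedIdeal (K : Submodule ℂ A) : Prop where
  closed : IsClosed (K : Set A)
  mul_left : ∀ a x, x ∈ K → a * x ∈ K
  mul_right : ∀ a x, x ∈ K → x * a ∈ K

/-- The closed two-sided ideal generated by a set. -/
def closedIdealSpan (S : Set A) : Submodule ℂ A :=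
  sInf {K | IsClosedIdeal K ∧ S ⊆ K}

lemma isClosedIdeal_closedIdealSpan (S : Set A) : IsClosedIdeal (closedIdealSpan S) where
  closed := by
    rw [closedIdealSpan, Submodule.coe_sInf]
    exact isClosed_biInter fun K hK => hK.1.closed
  mul_left a x hx := by
    rw [closedIdealSpan, Submodule.mem_sInf] at *
    exact fun K hK => hK.1.mul_left a x (hx K hK)
  mul_right a x hx := by
    rw [closedIdealSpan, Submodule.mem_sInf] at *
    exact fun K hK => hK.1.mul_right a x (hx K hK)

lemma subset_closedIdealSpan (S : Set A) : S ⊆ closedIdealSpan S := fun x hx => by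
  rw [SetLike.mem_coe, closedIdealSpan, Submodule.mem_sInf]
  exact fun K hK => hK.2 hx

lemma star_mem_closedIdealSpan {S : Set A} (hS : ∀ x ∈ S, star x ∈ closedIdealSpan S)
    {x : A} (hx : x ∈ closedIdealSpan S) : star x ∈ closedIdealSpan S := by
  have hI := isClosedIdeal_closedIdealSpan S
  let K : Submodule ℂ A :=
    { carrier := {y | star y ∈ closedIdealSpan S}
      add_mem' := fun {a b} ha hb => by
        simpa only [Set.mem_ofPred_eq, star_add] using add_mem ha hb
      zero_mem' := by simp
      smul_mem' := fun c a ha => by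
        simpa only [Set.mem_ofPred_eq, star_smul] using Submodule.smul_mem _ (star c) ha }
  have hK : IsClosedIdeal K :=
    { closed := hI.closed.preimage continuous_star
      mul_left := fun a y hy => by
        change star (a * y) ∈ closedIdealSpan S
        rw [star_mul]; exact hI.mul_right _ _ hy
      mul_right := fun a y hy => by
        change star (y * a) ∈ closedIdealSpan S
        rw [star_mul]; exact hI.mul_left _ _ hy }
  exact (sInf_le (a := K) ⟨hK, hS⟩ : closedIdealSpan S ≤ K) hx

variable (A) in
/-- Norm-closed two-sided ideals of a C⋆-algebra. Stability under the involution, which holds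
automatically, is recorded so that the quotient is visibly a ⋆-algebra. -/
structure CStarIdeal where
  /-- the underlying subspace -/
  carrier : Submodule ℂ A
  isClosedIdeal : IsClosedIdeal carrier
  star_mem : ∀ x ∈ carrier, star x ∈ carrier

namespace CStarIdeal

variable (I : CStarIdeal A)

instance : IsClosed (I.carrier : Set A) := I.isClosedIdeal.closed

/-- The quotient of a C⋆-algebra by a closed two-sided ideal. -/
def Quot : Type v := A ⧸ I.carrier

/-- The quotient norm `‖[x]‖ = inf {‖x + y‖ : y ∈ I}`. -/
instance : NormedAddCommGroup I.Quot := inferInstanceAs (NormedAddCommGroup (A ⧸ I.carrier))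
instance : NormedSpace ℂ I.Quot := inferInstanceAs (NormedSpace ℂ (A ⧸ I.carrier))
instance : CompleteSpace I.Quot := inferInstanceAs (CompleteSpace (A ⧸ I.carrier))

/-- The canonical projection. -/
def toQuot : A →ₗ[ℂ] I.Quot := I.carrier.mkQ

variable {I}

lemma mk_eq_mk {x y : A} : I.toQuot x = I.toQuot y ↔ x - y ∈ I.carrier := Submodule.Quotient.eq _

lemma mk_surjective : Function.Surjective I.toQuot := Submodule.mkQ_surjective _

instance : Mul I.Quot where
  mul := Quotient.map₂ (· * ·) (by
    intro a b hab c d hcd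
    have h1 := (Submodule.quotientRel_def _).1 hab
    have h2 := (Submodule.quotientRel_def _).1 hcd
    refine (Submodule.quotientRel_def _).2 ?_
    have : a * c - b * d = a * (c - d) + (a - b) * d := by
      rw [mul_sub, sub_mul]; abel
    change a * c - b * d ∈ _
    rw [this]
    exact add_mem (I.isClosedIdeal.mul_left _ _ h2) (I.isClosedIdeal.mul_right _ _ h1))

instance : Star I.Quot where
  star := Quotient.map star (by
    intro a b hab
    have h1 := (Submodule.quotientRel_def _).1 hab
    refine (Submodule.quotientRel_def _).2 ?_
    rw [← star_sub]
    exact I.star_mem _ h1)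

lemma mk_mul (x y : A) : I.toQuot (x * y) = I.toQuot x * I.toQuot y := rfl

lemma mk_star (x : A) : I.toQuot (star x) = star (I.toQuot x) := rfl

lemma norm_mk_lt (q : I.Quot) {ε : ℝ} (hε : 0 < ε) : ∃ x, I.toQuot x = q ∧ ‖x‖ < ‖q‖ + ε :=
  QuotientAddGroup.exists_norm_mk_lt (S := I.carrier.toAddSubgroup) q hε

lemma norm_mk_le (x : A) : ‖I.toQuot x‖ ≤ ‖x‖ :=
  QuotientAddGroup.norm_mk_le_norm (S := I.carrier.toAddSubgroup)

instance : NonUnitalNormedRing I.Quot where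
  left_distrib a b c := by
    obtain ⟨a, rfl⟩ := mk_surjective a; obtain ⟨b, rfl⟩ := mk_surjective b
    obtain ⟨c, rfl⟩ := mk_surjective c
    simp only [← mk_mul, ← map_add, mul_add]
  right_distrib a b c := by
    obtain ⟨a, rfl⟩ := mk_surjective a; obtain ⟨b, rfl⟩ := mk_surjective b
    obtain ⟨c, rfl⟩ := mk_surjective c
    simp only [← mk_mul, ← map_add, add_mul]
  zero_mul a := by
    obtain ⟨a, rfl⟩ := mk_surjective a
    rw [← map_zero I.toQuot, ← mk_mul, zero_mul]
  mul_zero a := by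
    obtain ⟨a, rfl⟩ := mk_surjective a
    rw [← map_zero I.toQuot, ← mk_mul, mul_zero]
  mul_assoc a b c := by
    obtain ⟨a, rfl⟩ := mk_surjective a; obtain ⟨b, rfl⟩ := mk_surjective b
    obtain ⟨c, rfl⟩ := mk_surjective c
    simp only [← mk_mul, mul_assoc]
  dist_eq := NormedAddGroup.dist_eq
  norm_mul_le a b := by
    have key : ∀ ε : ℝ, 0 < ε → ‖a * b‖ ≤ (‖a‖ + ε) * (‖b‖ + ε) := by
      intro ε hε
      obtain ⟨x, rfl, hx⟩ := norm_mk_lt a hε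
      obtain ⟨y, rfl, hy⟩ := norm_mk_lt b hε
      rw [← mk_mul]
      calc ‖I.toQuot (x * y)‖ ≤ ‖x * y‖ := norm_mk_le _
        _ ≤ ‖x‖ * ‖y‖ := norm_mul_le _ _
        _ ≤ _ := by gcongr
    have hlim : Filter.Tendsto (fun ε : ℝ => (‖a‖ + ε) * (‖b‖ + ε)) (nhdsWithin 0 (Set.Ioi 0))
        (nhds (‖a‖ * ‖b‖)) := by
      have : Continuous fun ε : ℝ => (‖a‖ + ε) * (‖b‖ + ε) := by fun_prop
      simpa using (this.tendsto 0).mono_left nhdsWithin_le_nhds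
    refine ge_of_tendsto hlim ?_
    filter_upwards [self_mem_nhdsWithin] with ε hε using key ε hε

instance : StarRing I.Quot where
  star_involutive a := by
    obtain ⟨a, rfl⟩ := mk_surjective a
    simp only [← mk_star, star_star]
  star_mul a b := by
    obtain ⟨a, rfl⟩ := mk_surjective a; obtain ⟨b, rfl⟩ := mk_surjective b
    simp only [← mk_star, ← mk_mul, star_mul]
  star_add a b := by
    obtain ⟨a, rfl⟩ := mk_surjective a; obtain ⟨b, rfl⟩ := mk_surjective b
    simp only [← mk_star, ← map_add, star_add]

end CStarIdeal

end Quotient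

/-- The closed two-sided ideal `J` of `O_{A_ℕ}` generated by `s₀ - s₀ s₀*`. -/
def J : CStarIdeal OAN.{u} where
  carrier := closedIdealSpan {OAN.s 0 - OAN.s 0 * star (OAN.s 0)}
  isClosedIdeal := isClosedIdeal_closedIdealSpan _
  star_mem _ hx := star_mem_closedIdealSpan (by
    rintro _ rfl
    have hI := isClosedIdeal_closedIdealSpan {OAN.s.{u} 0 - OAN.s 0 * star (OAN.s 0)}
    have hm := hI.mul_left (-star (OAN.s 0)) _ (subset_closedIdealSpan _ rfl)
    have h0 : star (OAN.s.{u} 0) * OAN.s 0 = OAN.s 0 * star (OAN.s 0) := by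
      simpa using OAN.rel.sum_range 0
    have h1 : star (OAN.s.{u} 0) * (OAN.s 0 * star (OAN.s 0)) = star (OAN.s 0) := by
      have := congrArg star (OAN.rel.{u}.partialIsometry 0)
      simpa [star_mul, mul_assoc] using this
    convert hm using 1
    rw [neg_mul, mul_sub, h1, h0, star_sub, star_mul, star_star, neg_sub]) hx

/-! ### The weakly monotone Fock space over `ℕ = {1, 2, …}` -/

/-- Words `i₁ ≥ i₂ ≥ ⋯ ≥ iₖ ≥ 1`; the empty word is allowed. -/
abbrev Word : Type := {l : List ℕ+ // l.IsChain (· ≥ ·)}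

/-- The weakly monotone Fock space: the Hilbert space with orthonormal basis
`e_{i₁} ⊗ ⋯ ⊗ e_{iₖ}`, `i₁ ≥ ⋯ ≥ iₖ ≥ 1`, `k ≥ 0`. -/
abbrev Fock : Type := lp (fun _ : Word => ℂ) 2

open Classical in
/-- The basis vector `e_{i₁} ⊗ ⋯ ⊗ e_{iₖ}`. -/
def basisVec (γ : Word) : Fock := lp.single 2 γ 1

lemma basisVec_self (γ : Word) : basisVec γ γ = 1 := by
  classical exact lp.single_apply_self (E := fun _ : Word => ℂ) 2 γ 1

lemma basisVec_ne {γ δ : Word} (h : δ ≠ γ) : basisVec γ δ = 0 := by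
  classical exact lp.single_apply_ne (E := fun _ : Word => ℂ) 2 γ 1 h

/-- The vacuum vector, indexed by the empty word. -/
def vac : Fock := basisVec ⟨[], List.isChain_nil⟩

/-- The coefficients of `A†ᵢ f`. -/
def creationFun (i : ℕ+) (f : Word → ℂ) : Word → ℂ
  | ⟨[], _⟩ => 0
  | ⟨j :: l, h⟩ => if j = i then f ⟨l, h.tail⟩ else 0

lemma creationFun_cons (i : ℕ+) (f : Word → ℂ) (j : ℕ+) (l : List ℕ+) (h) :
    creationFun i f ⟨j :: l, h⟩ = if j = i then f ⟨l, h.tail⟩ else 0 := rfl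

/-- Prepend the letter `i` to a word. -/
def consWord (i : ℕ+) (γ : {γ : Word // (i :: γ.1).IsChain (· ≥ ·)}) : Word := ⟨i :: γ.1.1, γ.2⟩

lemma consWord_injective (i : ℕ+) : Function.Injective (consWord i) := by
  rintro ⟨⟨a, ha⟩, ha'⟩ ⟨⟨b, hb⟩, hb'⟩ h
  have := congrArg Subtype.val h
  simp only [consWord, List.cons.injEq, true_and] at this
  subst this; rfl

lemma creationFun_eq_zero {i : ℕ+} {f : Word → ℂ} {γ : Word}
    (h : γ ∉ Set.range (consWord i)) : creationFun i f γ = 0 := by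
  obtain ⟨_ | ⟨j, l⟩, hl⟩ := γ
  · rfl
  · simp only [creationFun]
    split_ifs with hj
    · subst hj; exact absurd ⟨⟨⟨l, hl.tail⟩, hl⟩, rfl⟩ h
    · rfl

lemma creationFun_consWord (i : ℕ+) (f : Word → ℂ) (γ) :
    creationFun i f (consWord i γ) = f γ.1 := by
  simp only [consWord, creationFun, if_true]

lemma hasSum_sq (f : Fock) : HasSum (fun γ => ‖f γ‖ ^ 2) (‖f‖ ^ 2) := by
  simpa using lp.hasSum_norm (p := 2) (by norm_num) f

lemma creationFun_summable (i : ℕ+) (f : Fock) :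
    Summable fun γ => ‖creationFun i f γ‖ ^ 2 := by
  refine ((consWord_injective i).summable_iff fun γ hγ => ?_).1 ?_
  · rw [creationFun_eq_zero hγ]; simp
  · simp only [Function.comp_def, creationFun_consWord]
    exact (hasSum_sq f).summable.subtype _

lemma creationFun_memℓp (i : ℕ+) (f : Fock) : Memℓp (creationFun i f) 2 :=
  memℓp_gen (by simpa using creationFun_summable i f)

/-- `A†ᵢ` as a linear map. -/
def creationLin (i : ℕ+) : Fock →ₗ[ℂ] Fock where
  toFun f := ⟨creationFun i f, creationFun_memℓp i f⟩
  map_add' f g := by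
    apply Subtype.ext; funext ⟨l, hl⟩
    rcases l with _ | ⟨j, l⟩
    · exact (add_zero (0 : ℂ)).symm
    · change creationFun i (f + g) ⟨j :: l, hl⟩ =
        creationFun i f ⟨j :: l, hl⟩ + creationFun i g ⟨j :: l, hl⟩
      by_cases hj : j = i <;> simp only [creationFun_cons, hj, if_true, if_false]
      · rfl
      · exact (add_zero (0 : ℂ)).symm
  map_smul' c f := by
    apply Subtype.ext; funext ⟨l, hl⟩
    rcases l with _ | ⟨j, l⟩
    · exact (mul_zero c).symm
    · change creationFun i (c • f) ⟨j :: l, hl⟩ = c * creationFun i f ⟨j :: l, hl⟩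
      by_cases hj : j = i <;> simp only [creationFun_cons, hj, if_true, if_false]
      · rfl
      · exact (mul_zero c).symm

/-- The weakly monotone creator `A†ᵢ`; see `creation_basisVec` for its action on the basis. -/
def creation (i : ℕ+) : Fock →L[ℂ] Fock :=
  (creationLin i).mkContinuous 1 fun f => by
    rw [one_mul]
    refine le_of_sq_le_sq ?_ (norm_nonneg _)
    rw [← (hasSum_sq f).tsum_eq, ← (hasSum_sq (creationLin i f)).tsum_eq]
    have h1 : ∑' γ, ‖creationLin i f γ‖ ^ 2 = ∑' γ, ‖creationFun i f (consWord i γ)‖ ^ 2 :=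
      ((consWord_injective i).tsum_eq (f := fun γ => ‖creationFun i f γ‖ ^ 2) fun γ hγ => by
        by_contra h
        exact hγ (by simp [creationFun_eq_zero h])).symm
    rw [h1]
    simp only [creationFun_consWord]
    exact Summable.tsum_subtype_le (fun γ => ‖f γ‖ ^ 2) _ (fun _ => by positivity)
      (hasSum_sq f).summable

open Classical in
/-- `A†ᵢ e_{i₁} ⊗ ⋯ ⊗ e_{iₖ} = eᵢ ⊗ e_{i₁} ⊗ ⋯ ⊗ e_{iₖ}` if the word is empty or `i ≥ i₁`,
and `0` otherwise. -/
theorem creation_basisVec (i : ℕ+) (γ : Word) :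
    creation i (basisVec γ) = if h : ∀ j ∈ γ.1.head?, i ≥ j then
      basisVec ⟨i :: γ.1, List.isChain_cons.2 ⟨h, γ.2⟩⟩ else 0 := by
  apply Subtype.ext; funext δ
  change creationFun i (basisVec γ) δ = _
  by_cases hδ : δ ∈ Set.range (consWord i)
  · obtain ⟨ε, rfl⟩ := hδ
    rw [creationFun_consWord]
    have hε := ε.2
    split_ifs with h
    · by_cases hγ : ε.1 = γ
      · subst hγ; rw [basisVec_self]; exact (basisVec_self _).symm
      · rw [basisVec_ne hγ]
        refine (basisVec_ne ?_).symm
        intro h'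
        apply hγ
        have := congrArg Subtype.val h'
        simp only [consWord, List.cons.injEq, true_and] at this
        exact Subtype.ext this
    · have hγ : ε.1 ≠ γ := by
        rintro rfl; exact h (List.isChain_cons.1 hε).1
      rw [basisVec_ne hγ]; rfl
  · rw [creationFun_eq_zero hδ]
    split_ifs with h
    · refine (basisVec_ne ?_).symm
      rintro rfl
      exact hδ ⟨⟨γ, List.isChain_cons.2 ⟨h, γ.2⟩⟩, rfl⟩
    · rfl

/-- The annihilator `Aᵢ`, the adjoint of `A†ᵢ`. -/
def annihilation (i : ℕ+) : Fock →L[ℂ] Fock := ContinuousLinearMap.adjoint (creation i)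

/-- The orthogonal projection `P_Ω` onto the span of the vacuum vector. -/
def vacProj : Fock →L[ℂ] Fock := (Submodule.span ℂ {vac}).starProjection

/-- The weakly monotone C⋆-algebra `𝒲_ℕ`: the (non-unital) C⋆-algebra of operators generated by
all creators and annihilators. -/
def weaklyMonotoneAlg : NonUnitalStarSubalgebra ℂ (Fock →L[ℂ] Fock) :=
  (NonUnitalStarAlgebra.adjoin ℂ
    (Set.range annihilation ∪ Set.range creation)).topologicalClosure

instance : IsClosed (weaklyMonotoneAlg : Set (Fock →L[ℂ] Fock)) :=
  NonUnitalStarSubalgebra.isClosed_topologicalClosure _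

/-- The images of the generators under the Fock representation: `s₀ ↦ P_Ω`, `sᵢ ↦ A†ᵢ`
for `i ≥ 1`. -/
def fockGen : ℕ → (Fock →L[ℂ] Fock)
  | 0 => vacProj
  | n + 1 => creation n.succPNat

end WeaklyMonotone

end

noncomputable section

open scoped ENNReal

namespace WeaklyMonotone

/-! ### The quotient of a C⋆-algebra by a closed ideal is a C⋆-algebra -/

namespace CStarIdeal

variable {A : Type v} [NonUnitalCStarAlgebra A]

/-! Everything rests on `norm_map_eq`: if `D` is generated as a C⋆-algebra by a family `t`
satisfying `VacuumRel`, and `π` sends `t i` to `fockGen i`, then `π` is isometric. It is applied to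
the universal algebra with the vacuum relation and to the quotient of `OAN` by `J`.

The reason is polynomial growth. A ⋆-polynomial involves only t₀, …, tₙ, and qₙ = tₙ* tₙ is a unit
for the algebra they generate. The relations bring every such element to a combination of products
t_μ t_ν* and t_μ t₀ t_ν*, where μ, ν are weakly decreasing words with letters at most n, because tᵢ
tⱼ = 0 for i < j. Inserting qₙ = t₀ + ∑_{1 ≤ k ≤ n} tₖ tₖ* between t_μ and t_ν* lengthens the words,
so that all terms can be taken from the monomials of one level L. In Fock space these monomials are
biorthogonal to the matrix units of words of length at most L (`monomial_fockGen_entry`). An element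
x of level L is therefore recovered from the entries of π(x).

A weakly decreasing word is determined by the multiplicities of its letters, so there are at most
(L+1)ⁿ words and ‖x‖ ≤ (L+1)²ⁿ ‖π(x)‖ (`norm_le_of_mem_level`). The level of a power grows linearly
in the exponent. Applying the bound to the 2ʲ-th powers of the self-adjoint element x* x, where the
C⋆-identity gives ‖y^(2ʲ)‖ = ‖y‖^(2ʲ), makes the polynomial factor disappear in the limit, and ‖x‖ ≤
‖π(x)‖ follows on a dense subalgebra.

An isometric image is closed, so it is all of 𝒲_ℕ once it lies in 𝒲_ℕ and contains the creators; it
lies there because P_Ω = A₁A₁† − A₁†A₁. For the quotient one also needs that it is a C⋆-algebra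
(`norm_toQuot_sq_le`) and that the Fock representation kills `J`, which holds because the Fock
generators satisfy the vacuum relation. -/

lemma norm_sub_star_mul_self_mul_le {b : A} (hb : ‖star b * b‖ ≤ 1) (z : A) :
    ‖z - star b * b * z‖ ≤ ‖z‖ := by
  let := CStarAlgebra.spectralOrder A
  have := CStarAlgebra.spectralOrderedRing A
  -- The general estimate compares b* b with a smaller positive element. Taking 0 for that element
  -- leaves only the condition ‖z* z‖ ≤ ‖z‖² in the unitization.
  refine CStarAlgebra.norm_sub_mul_self_le_of_inr z le_rfl (star_mul_self_nonneg b) hb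
    (norm_nonneg z) ?_
  rw [Unitization.inr_zero, sub_zero, mul_one, CStarRing.norm_star_mul_self,
    Unitization.norm_inr, sq]

/-- A closed ideal as a C⋆-subalgebra. -/
def toSubalgebra (I : CStarIdeal A) : NonUnitalStarSubalgebra ℂ A where
  carrier := I.carrier
  add_mem' := add_mem
  zero_mem' := zero_mem _
  mul_mem' _ hb := I.isClosedIdeal.mul_left _ _ hb
  smul_mem' c _ hx := I.carrier.smul_mem c hx
  star_mem' hx := I.star_mem _ hx

instance (I : CStarIdeal A) : IsClosed (I.toSubalgebra : Set A) := I.isClosedIdeal.closed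

/-- A closed ideal has positive contractions that almost act as a right unit on a given
element. -/
lemma exists_approx_unit (I : CStarIdeal A) {y : A} (hy : y ∈ I.carrier) {ε : ℝ} (hε : 0 < ε) :
    ∃ b : A, star b * b ∈ I.carrier ∧ ‖star b * b‖ ≤ 1 ∧ ‖y - y * (star b * b)‖ < ε := by
  let := CStarAlgebra.spectralOrder I.toSubalgebra
  have := CStarAlgebra.spectralOrderedRing I.toSubalgebra
  have hl := CStarAlgebra.increasingApproximateUnit I.toSubalgebra
  have := hl.neBot
  have h1 := hl.tendsto_mul_left ⟨y, hy⟩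
  have h2 := (Metric.tendsto_nhds.1 h1) ε hε
  obtain ⟨e, he, he0, he1⟩ := (h2.and (hl.eventually_nonneg.and hl.eventually_norm)).exists
  obtain ⟨b, rfl⟩ := CStarAlgebra.nonneg_iff_eq_star_mul_self.1 he0
  refine ⟨b, (star b * b).2, he1, ?_⟩
  rw [dist_comm, dist_eq_norm] at he
  exact he

/-- For e an approximate unit of the ideal, x and x(1 − e) have the same class, so with a = x* x one
gets ‖[x]‖² ≤ ‖(1 − e)a(1 − e)‖ ≤ ‖(a + y)(1 − e)‖ + ‖y(1 − e)‖. The last term is small and 1 − e is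
a contraction. The infimum over y gives the C⋆-inequality for the quotient norm. -/
lemma norm_toQuot_sq_le (I : CStarIdeal A) (x y : A) (hy : y ∈ I.carrier) :
    ‖I.toQuot x‖ * ‖I.toQuot x‖ ≤ ‖star x * x + y‖ := by
  refine le_of_forall_pos_lt_add fun ε hε => ?_
  obtain ⟨b, hbI, hb1, hb⟩ := I.exists_approx_unit hy hε
  set e := star b * b with he
  have hse : star e = e := by simp [he]
  have hright : ∀ z : A, ‖z - z * e‖ ≤ ‖z‖ := fun z => by
    have := norm_sub_star_mul_self_mul_le hb1 (star z)
    rw [← he, ← norm_star, star_sub, star_mul, star_star, hse, norm_star] at this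
    exact this
  have hq : I.toQuot x = I.toQuot (x - x * e) := by
    rw [mk_eq_mk, sub_sub_cancel]
    exact I.isClosedIdeal.mul_left _ _ hbI
  set a := star x * x with ha
  have hexp : star (x - x * e) * (x - x * e) = (a - a * e) - e * (a - a * e) := by
    rw [star_sub, star_mul, hse, ha]; noncomm_ring
  have hsplit : a - a * e = ((a + y) - (a + y) * e) - (y - y * e) := by
    rw [add_mul]; abel
  calc ‖I.toQuot x‖ * ‖I.toQuot x‖ ≤ ‖x - x * e‖ * ‖x - x * e‖ := by
        rw [hq]; exact mul_self_le_mul_self (norm_nonneg _) (norm_mk_le _)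
    _ = ‖(a - a * e) - e * (a - a * e)‖ := by rw [← CStarRing.norm_star_mul_self, hexp]
    _ ≤ ‖a - a * e‖ := norm_sub_star_mul_self_mul_le hb1 _
    _ ≤ ‖(a + y) - (a + y) * e‖ + ‖y - y * e‖ := by rw [hsplit]; exact norm_sub_le _ _
    _ < ‖a + y‖ + ε := add_lt_add_of_le_of_lt (hright _) hb

variable {I : CStarIdeal A}

instance : CStarRing I.Quot where
  norm_mul_self_le q := by
    obtain ⟨x, rfl⟩ := mk_surjective q
    rw [← mk_star, ← mk_mul]
    refine le_of_forall_pos_le_add fun ε hε => ?_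
    obtain ⟨z, hz, hlt⟩ := norm_mk_lt (I.toQuot (star x * x)) hε
    have := norm_toQuot_sq_le I x (z - star x * x) (mk_eq_mk.1 hz)
    rw [add_sub_cancel] at this
    exact this.trans hlt.le

instance : NonUnitalCStarAlgebra I.Quot where
  smul_assoc c a b := by
    obtain ⟨a, rfl⟩ := mk_surjective a; obtain ⟨b, rfl⟩ := mk_surjective b
    simp only [smul_eq_mul, ← map_smul, ← mk_mul, smul_mul_assoc]
  smul_comm c a b := by
    obtain ⟨a, rfl⟩ := mk_surjective a; obtain ⟨b, rfl⟩ := mk_surjective b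
    simp only [smul_eq_mul, ← map_smul, ← mk_mul, mul_smul_comm]
  star_smul c a := by
    obtain ⟨a, rfl⟩ := mk_surjective a
    simp only [← map_smul, ← mk_star, star_smul]

variable (I) in
/-- The quotient map as a ⋆-homomorphism. -/
def quotHom : A →⋆ₙₐ[ℂ] I.Quot where
  toFun := I.toQuot
  map_smul' c x := map_smul I.toQuot c x
  map_zero' := map_zero I.toQuot
  map_add' := map_add I.toQuot
  map_mul' := mk_mul
  map_star' := mk_star

/-- A ⋆-homomorphism vanishing on a closed ideal factors through the quotient. -/
def quotLift {B : Type u} [NonUnitalCStarAlgebra B] (φ : A →⋆ₙₐ[ℂ] B)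
    (h : ∀ x ∈ I.carrier, φ x = 0) : I.Quot →⋆ₙₐ[ℂ] B :=
  let f : I.Quot →ₗ[ℂ] B := I.carrier.liftQ (φ : A →ₗ[ℂ] B) h
  { toFun := f
    map_smul' := fun c x => map_smul f c x
    map_zero' := map_zero f
    map_add' := map_add f
    map_mul' := fun a b => by
      obtain ⟨a, rfl⟩ := mk_surjective a; obtain ⟨b, rfl⟩ := mk_surjective b
      exact map_mul φ a b
    map_star' := fun a => by
      obtain ⟨a, rfl⟩ := mk_surjective a
      exact map_star φ a }

end CStarIdeal

/-! ### The Fock representation -/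

lemma inner_basisVec_left (γ : Word) (f : Fock) : inner ℂ (basisVec γ) f = f γ := by
  classical
  have := lp.inner_single_left (𝕜 := ℂ) (G := fun _ : Word => ℂ) γ 1 f
  rw [basisVec]
  convert this using 1
  simp

lemma norm_basisVec (γ : Word) : ‖basisVec γ‖ = 1 := by
  classical
  have := lp.norm_single (E := fun _ : Word => ℂ) (p := 2) (by norm_num) γ 1
  rw [basisVec]
  convert this using 1
  simp

lemma norm_entry_le (T : Fock →L[ℂ] Fock) (α β : Word) : ‖T (basisVec β) α‖ ≤ ‖T‖ := by
  rw [← inner_basisVec_left]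
  refine (norm_inner_le_norm _ _).trans ?_
  rw [norm_basisVec, one_mul]
  simpa [norm_basisVec] using T.le_opNorm (basisVec β)

lemma ext_basisVec {S T : Fock →L[ℂ] Fock} (h : ∀ γ, S (basisVec γ) = T (basisVec γ)) : S = T := by
  classical
  refine lp.ext_continuousLinearMap (by norm_num) fun γ => ?_
  ext1
  have hγ : lp.singleContinuousLinearMap ℂ (fun _ : Word => ℂ) 2 γ 1 = basisVec γ := by
    rw [basisVec]; rfl
  rw [ContinuousLinearMap.comp_apply, ContinuousLinearMap.comp_apply, hγ, h γ]

lemma annihilation_apply (i : ℕ+) (f : Fock) (γ : Word) :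
    annihilation i f γ = inner ℂ (creation i (basisVec γ)) f := by
  rw [← inner_basisVec_left, annihilation, ContinuousLinearMap.adjoint_inner_right]

lemma annihilation_nil (i : ℕ+) : annihilation i vac = 0 := by
  classical
  ext γ
  rw [annihilation_apply, creation_basisVec]
  split_ifs with h
  · rw [inner_basisVec_left, vac, basisVec_ne (by simp)]; rfl
  · rw [inner_zero_left]; rfl

lemma annihilation_cons (i j : ℕ+) (l : List ℕ+) (h : (j :: l).IsChain (· ≥ ·)) :
    annihilation i (basisVec ⟨j :: l, h⟩) = if j = i then basisVec ⟨l, h.tail⟩ else 0 := by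
  classical
  ext γ
  rw [annihilation_apply, creation_basisVec]
  split_ifs with h1 h2 h2
  · subst h2
    rw [inner_basisVec_left]
    by_cases hγ : γ = ⟨l, h.tail⟩
    · subst hγ; rw [basisVec_self, basisVec_self]
    · rw [basisVec_ne hγ, basisVec_ne]
      intro h'
      have := congrArg Subtype.val h'
      simp only [List.cons.injEq, true_and] at this
      exact hγ (Subtype.ext this)
  · rw [inner_basisVec_left, basisVec_ne]
    · rfl
    · intro h'
      have := congrArg Subtype.val h'
      simp only [List.cons.injEq] at this
      exact h2 this.1.symm
  · subst h2
    rw [inner_zero_left, basisVec_ne]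
    rintro rfl
    exact h1 (List.isChain_cons.1 h).1
  · rw [inner_zero_left]; rfl

lemma vacProj_apply (f : Fock) : vacProj f = f ⟨[], List.isChain_nil⟩ • vac := by
  have hv : ‖vac‖ = 1 := norm_basisVec _
  have h := Submodule.starProjection_unit_singleton ℂ hv f
  rw [vacProj, h, ← inner_basisVec_left]
  rfl

lemma vacProj_vac : vacProj vac = vac := by
  rw [vacProj_apply, vac, basisVec_self, one_smul]

lemma vacProj_cons (j : ℕ+) (l : List ℕ+) (h : (j :: l).IsChain (· ≥ ·)) :
    vacProj (basisVec ⟨j :: l, h⟩) = 0 := by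
  rw [vacProj_apply, basisVec_ne (by simp), zero_smul]

lemma star_creation (i : ℕ+) : star (creation i) = annihilation i := rfl

lemma star_vacProj : star vacProj = vacProj :=
  (isStarProjection_starProjection (U := Submodule.span ℂ {vac})).isSelfAdjoint

lemma fockGen_succ (n : ℕ) : fockGen (n + 1) = creation n.succPNat := rfl

lemma creation_annihilation_cons (i j : ℕ+) (l : List ℕ+) (h : (j :: l).IsChain (· ≥ ·)) :
    creation i (annihilation i (basisVec ⟨j :: l, h⟩)) =
      if j = i then basisVec ⟨j :: l, h⟩ else 0 := by
  classical
  rw [annihilation_cons]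
  split_ifs with hj
  · subst hj
    rw [creation_basisVec, dif_pos (List.isChain_cons.1 h).1]
  · exact map_zero _

lemma annihilation_creation (i : ℕ+) (γ : Word) [Decidable (∀ j ∈ γ.1.head?, i ≥ j)] :
    annihilation i (creation i (basisVec γ)) =
      if ∀ j ∈ γ.1.head?, i ≥ j then basisVec γ else 0 := by
  classical
  rw [creation_basisVec]
  split_ifs with h
  · rw [annihilation_cons, if_pos rfl]
  · exact map_zero _

/-- On the basis, AᵢAᵢ† keeps the words whose first letter is at most i, together with the vacuum,
while Aₖ†Aₖ keeps those beginning with k. The sum relation sorts words by their first letter, P_Ω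
accounting for the empty one. -/
lemma fockGen_rel : VacuumRel fockGen := by
  classical
  have hproj : vacProj * vacProj = vacProj :=
    (isStarProjection_starProjection (U := Submodule.span ℂ {vac})).isIdempotentElem
  have hpi : ∀ i, creation i * annihilation i * creation i = creation i := fun i => by
    refine ext_basisVec fun γ => ?_
    rw [mul_apply_eq_comp, mul_apply_eq_comp, annihilation_creation]
    split_ifs with h
    · rfl
    · rw [map_zero, creation_basisVec, dif_neg h]
  have hvc : ∀ i, vacProj * creation i = 0 := fun i => by
    refine ext_basisVec fun γ => ?_
    rw [mul_apply_eq_comp, creation_basisVec]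
    split_ifs with h
    · exact vacProj_cons _ _ _
    · exact map_zero _
  refine ⟨⟨?_, ?_, ?_⟩, ?_⟩
  · rintro (_ | i)
    · change vacProj * star vacProj * vacProj = vacProj
      rw [star_vacProj, hproj, hproj]
    · exact hpi _
  · rintro (_ | i) (_ | j) hij
    · exact absurd rfl hij
    · change star vacProj * creation _ = 0
      rw [star_vacProj, hvc]
    · change star (creation _) * vacProj = 0
      rw [← star_vacProj, ← star_mul, hvc, star_zero]
    · refine ext_basisVec fun γ => ?_
      rw [fockGen_succ, fockGen_succ, mul_apply_eq_comp, creation_basisVec,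
        star_creation]
      split_ifs with h
      · rw [annihilation_cons, if_neg]
        · rfl
        · intro h'; exact hij (by rw [Nat.succPNat_injective h'])
      · exact map_zero _
  · rintro (_ | i)
    · simp only [zero_add, Finset.range_one, Finset.sum_singleton]
      change star vacProj * vacProj = vacProj * star vacProj
      rw [star_vacProj]
    · refine ext_basisVec fun γ => ?_
      have hs : ∀ k, fockGen (k + 1) * star (fockGen (k + 1)) =
        creation k.succPNat * annihilation k.succPNat := fun _ => rfl
      have h0 : fockGen 0 * star (fockGen 0) = vacProj := by
        change vacProj * star vacProj = vacProj
        rw [star_vacProj, hproj]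
      rw [Finset.sum_range_succ', h0, Finset.sum_congr rfl fun k _ => hs k, add_apply, sum_apply,
        fockGen_succ, star_creation, mul_apply_eq_comp, annihilation_creation]
      simp only [mul_apply_eq_comp]
      obtain ⟨_ | ⟨j, l⟩, hl⟩ := γ
      · have h0 : ∀ k, annihilation k (basisVec ⟨[], hl⟩) = 0 := annihilation_nil
        have h1 : vacProj (basisVec ⟨[], hl⟩) = basisVec ⟨[], hl⟩ := vacProj_vac
        simp [h0, h1]
      -- Generator k + 1 creates the letter k + 1, so a word beginning with j meets only the summand
      -- with index j − 1.
      · have hj : ∀ k : ℕ, j = k.succPNat ↔ j.natPred = k := fun k =>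
          ⟨fun h => by rw [h, Nat.natPred_succPNat], fun h => by rw [← h, PNat.succPNat_natPred]⟩
        have hle : i.succPNat ≥ j ↔ j.natPred ∈ Finset.range (i + 1) := by
          rw [Finset.mem_range, Nat.lt_succ_iff, ge_iff_le, ← PNat.natPred_le_natPred,
            Nat.natPred_succPNat]
        simp only [creation_annihilation_cons, vacProj_cons, add_zero, List.head?_cons,
          Option.mem_def, Option.some.injEq, forall_eq', hj, Finset.sum_ite_eq, hle]
  · change vacProj = vacProj * star vacProj
    rw [star_vacProj, hproj]

/-! ### Words in the generators -/

section Relations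

variable {D : Type v} [NonUnitalCStarAlgebra D] {t : ℕ → D}

/-- The initial projection of `tₙ`, a unit for the algebra generated by `t₀, …, tₙ`. -/
def initialProj (t : ℕ → D) (n : ℕ) : D := star (t n) * t n

lemma star_initialProj (t : ℕ → D) (n : ℕ) : star (initialProj t n) = initialProj t n := by
  simp [initialProj]

namespace MonotoneRel

lemma initialProj_mul (ht : MonotoneRel t) {k n : ℕ} (h : k ≤ n) : initialProj t n * t k = t k := by
  rw [initialProj, ht.sum_range, Finset.sum_mul, Finset.sum_eq_single k]
  · exact ht.partialIsometry k
  · intro j _ hj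
    rw [mul_assoc, ht.orthogonal j k hj, mul_zero]
  · intro hk
    exact absurd (Finset.mem_range.2 (Nat.lt_succ_of_le h)) hk

lemma initialProj_mul_of_lt (ht : MonotoneRel t)
    {k n : ℕ} (h : n < k) : initialProj t n * t k = 0 := by
  rw [initialProj, ht.sum_range, Finset.sum_mul]
  refine Finset.sum_eq_zero fun j hj => ?_
  have : j ≠ k := by have := Finset.mem_range.1 hj; omega
  rw [mul_assoc, ht.orthogonal j k this, mul_zero]

lemma initialProj_mul_initialProj (ht : MonotoneRel t) {k n : ℕ} (h : k ≤ n) :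
    initialProj t k * initialProj t n = initialProj t k := by
  have hs : initialProj t k = ∑ j ∈ Finset.range (k + 1), t j * star (t j) := ht.sum_range k
  rw [hs, Finset.sum_mul]
  refine Finset.sum_congr rfl fun j hj => ?_
  have hj : j ≤ n := by have := Finset.mem_range.1 hj; omega
  have := congrArg star (ht.initialProj_mul hj)
  rw [star_mul, star_initialProj] at this
  rw [mul_assoc, this]

lemma mul_initialProj_self (ht : MonotoneRel t) (k : ℕ) : t k * initialProj t k = t k := by
  rw [initialProj, ← mul_assoc, ht.partialIsometry]

lemma mul_initialProj (ht : MonotoneRel t) {k n : ℕ} (h : k ≤ n) : t k * initialProj t n = t k := by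
  rw [← ht.mul_initialProj_self k, mul_assoc, ht.initialProj_mul_initialProj h]

/-- The initial projection of tᵢ is the sum of the range projections of t₀, …, tᵢ, which are
orthogonal to the range of tⱼ. This is weak monotonicity in algebraic form. -/
lemma mul_eq_zero_of_lt (ht : MonotoneRel t) {i j : ℕ} (h : i < j) : t i * t j = 0 := by
  rw [← ht.mul_initialProj_self i, mul_assoc, ht.initialProj_mul_of_lt h, mul_zero]

lemma norm_gen_le (ht : MonotoneRel t)
    (i : ℕ) : ‖t i‖ ≤ 1 := norm_le_one_of_partialIsometry (ht.partialIsometry i)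

lemma norm_initialProj_le (ht : MonotoneRel t) (i : ℕ) : ‖initialProj t i‖ ≤ 1 := by
  rw [initialProj, CStarRing.norm_star_mul_self]
  exact mul_le_one₀ (ht.norm_gen_le i) (norm_nonneg _) (ht.norm_gen_le i)

end MonotoneRel

namespace VacuumRel

lemma star_zero_gen (ht : VacuumRel t) : star (t 0) = t 0 := by
  rw [ht.vacuum, star_mul, star_star]

lemma zero_gen_mul_self (ht : VacuumRel t) : t 0 * t 0 = t 0 := by
  have := ht.vacuum
  rw [ht.star_zero_gen] at this
  exact this.symm

lemma initialProj_eq (ht : VacuumRel t) (i : ℕ) :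
    initialProj t i = (∑ k ∈ Finset.range i, t (k + 1) * star (t (k + 1))) + t 0 := by
  rw [initialProj, ht.sum_range, Finset.sum_range_succ', ← ht.vacuum]

lemma zero_gen_mul (ht : VacuumRel t) {i : ℕ} (hi : i ≠ 0) : t 0 * t i = 0 := by
  rw [← ht.star_zero_gen, ht.orthogonal 0 i hi.symm]

lemma star_mul_zero_gen (ht : VacuumRel t)
    {i : ℕ} (hi : i ≠ 0) : star (t i) * t 0 = 0 := ht.orthogonal i 0 hi

end VacuumRel

/-- The product `t_{i₁} ⋯ t_{iₖ}`, the empty product being the unit of the algebra generated by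
`t₀, …, tₙ`. -/
def wordProd (t : ℕ → D) (n : ℕ) : List ℕ+ → D
  | [] => initialProj t n
  | i :: l => t i * wordProd t n l

@[simp] lemma wordProd_nil (t : ℕ → D) (n : ℕ) : wordProd t n [] = initialProj t n := rfl

@[simp] lemma wordProd_cons (t : ℕ → D) (n : ℕ) (i : ℕ+) (l : List ℕ+) :
    wordProd t n (i :: l) = t i * wordProd t n l := rfl

section WordProd

variable {n : ℕ}

lemma wordProd_mul_initialProj (ht : MonotoneRel t) (l : List ℕ+) :
    wordProd t n l * initialProj t n = wordProd t n l := by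
  induction l with
  | nil => exact ht.initialProj_mul_initialProj le_rfl
  | cons i l ih => rw [wordProd_cons, mul_assoc, ih]

lemma initialProj_mul_star_wordProd (ht : MonotoneRel t) (l : List ℕ+) :
    initialProj t n * star (wordProd t n l) = star (wordProd t n l) := by
  rw [← star_initialProj, ← star_mul, wordProd_mul_initialProj ht]

lemma wordProd_mul_gen (ht : MonotoneRel t) (l : List ℕ+) {k : ℕ+} (hk : (k : ℕ) ≤ n) :
    wordProd t n l * t k = wordProd t n (l ++ [k]) := by
  induction l with
  | nil =>
    rw [List.nil_append, wordProd_cons, wordProd_nil, ht.initialProj_mul hk, ht.mul_initialProj hk]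
  | cons i l ih => rw [List.cons_append, wordProd_cons, wordProd_cons, mul_assoc, ih]

/-- A word that is not weakly decreasing has an adjacent ascent i < j, and tᵢ tⱼ = 0 there. Hence
later lemmas can work with arbitrary lists. -/
lemma wordProd_eq_zero (ht : MonotoneRel t)
    {l : List ℕ+} (h : ¬ l.IsChain (· ≥ ·)) : wordProd t n l = 0 := by
  induction l with
  | nil => exact absurd List.isChain_nil h
  | cons i l ih =>
    rw [wordProd_cons]
    by_cases hl : l.IsChain (· ≥ ·)
    · cases l with
      | nil => exact absurd (List.isChain_singleton i) h
      | cons j l =>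
        have hij : (i : ℕ) < j := by
          by_contra! hij
          exact h (List.isChain_cons_cons.2 ⟨hij, hl⟩)
        rw [wordProd_cons, ← mul_assoc, ht.mul_eq_zero_of_lt hij, zero_mul]
    · rw [ih hl, mul_zero]

lemma norm_wordProd_le (ht : MonotoneRel t) (l : List ℕ+) : ‖wordProd t n l‖ ≤ 1 := by
  induction l with
  | nil => exact ht.norm_initialProj_le n
  | cons i l ih =>
    exact (norm_mul_le _ _).trans (mul_le_one₀ (ht.norm_gen_le i) (norm_nonneg _) ih)

end WordProd

/-- The words of length at most `L` with letters at most `n`. -/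
def boundedWords (n L : ℕ) : Set Word := {w | (∀ i ∈ w.1, (i : ℕ) ≤ n) ∧ w.1.length ≤ L}

/-- The normally ordered monomials: `t_μ t_ν*` if the longer word has length `L`, and `t_μ t₀ t_ν*`
otherwise. Their images in the Fock representation are biorthogonal to the matrix units indexed by
words of length at most `L`. -/
def monomial (t : ℕ → D) (n L : ℕ) (μ ν : Word) : D :=
  if max μ.1.length ν.1.length = L then wordProd t n μ.1 * star (wordProd t n ν.1)
  else wordProd t n μ.1 * t 0 * star (wordProd t n ν.1)

/-- The span of the normally ordered monomials of level `L`. -/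
def level (t : ℕ → D) (n L : ℕ) : Submodule ℂ D :=
  Submodule.span ℂ {x | ∃ μ ∈ boundedWords n L, ∃ ν ∈ boundedWords n L, x = monomial t n L μ ν}

/-- To check a linear condition on `level t n L` it suffices to check it on the products
`t_μ t_ν*` and `t_μ t₀ t_ν*`. -/
lemma level_induction {n L : ℕ} {K : Submodule ℂ D} (f : D →ₗ[ℂ] D)
    (he : ∀ μ ν : List ℕ+, (∀ i ∈ μ, (i : ℕ) ≤ n) → (∀ i ∈ ν, (i : ℕ) ≤ n) → μ.length ≤ L →
      ν.length ≤ L → f (wordProd t n μ * star (wordProd t n ν)) ∈ K)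
    (hf : ∀ μ ν : List ℕ+, (∀ i ∈ μ, (i : ℕ) ≤ n) → (∀ i ∈ ν, (i : ℕ) ≤ n) → μ.length < L →
      ν.length < L → f (wordProd t n μ * t 0 * star (wordProd t n ν)) ∈ K)
    {x : D} (hx : x ∈ level t n L) : f x ∈ K := by
  have : level t n L ≤ K.comap f := by
    refine Submodule.span_le.2 ?_
    rintro _ ⟨μ, hμ, ν, hν, rfl⟩
    rw [SetLike.mem_coe, Submodule.mem_comap, monomial]
    have := hμ.2
    have := hν.2
    split_ifs with h
    · exact he _ _ hμ.1 hν.1 hμ.2 hν.2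
    · exact hf _ _ hμ.1 hν.1 (by omega) (by omega)
  exact this hx

/-! ### Normal ordering and the action of the generators on levels -/

section Level

variable {n : ℕ}

lemma wordProd_mul_vacuum_mul_mem_level (ht : VacuumRel t)
    {L : ℕ} {μ ν : List ℕ+} (hμ : ∀ i ∈ μ, (i : ℕ) ≤ n)
    (hν : ∀ i ∈ ν, (i : ℕ) ≤ n) (hμL : μ.length < L) (hνL : ν.length < L) :
    wordProd t n μ * t 0 * star (wordProd t n ν) ∈ level t n L := by
  by_cases h1 : μ.IsChain (· ≥ ·)
  · by_cases h2 : ν.IsChain (· ≥ ·)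
    · refine Submodule.subset_span ⟨⟨μ, h1⟩, ⟨hμ, hμL.le⟩, ⟨ν, h2⟩, ⟨hν, hνL.le⟩, ?_⟩
      rw [monomial, if_neg]
      exact (max_lt hμL hνL).ne
    · rw [wordProd_eq_zero ht.toMonotoneRel h2, star_zero, mul_zero]; exact zero_mem _
  · rw [wordProd_eq_zero ht.toMonotoneRel h1, zero_mul, zero_mul]; exact zero_mem _

/-- Insert the unit qₙ = t₀ + ∑ tₖ tₖ* in the middle: each term either lengthens both words by the
same letter or acquires a t₀. -/
lemma wordProd_mul_star_eq (ht : VacuumRel t) (μ ν : List ℕ+) :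
    wordProd t n μ * star (wordProd t n ν) =
      (∑ k ∈ Finset.range n, wordProd t n (μ ++ [k.succPNat]) *
        star (wordProd t n (ν ++ [k.succPNat]))) + wordProd t n μ * t 0 * star (wordProd t n ν) := by
  have h := ht.toMonotoneRel
  conv_lhs => rw [← wordProd_mul_initialProj h μ, ht.initialProj_eq, mul_add, add_mul,
    Finset.mul_sum, Finset.sum_mul]
  congr 1
  refine Finset.sum_congr rfl fun k hk => ?_
  -- The index k < n stands for the letter k + 1, so the letters run through 1, …, n.
  have hk : ((k.succPNat : ℕ+) : ℕ) ≤ n := Finset.mem_range.1 hk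
  rw [← wordProd_mul_gen h μ hk, ← wordProd_mul_gen h ν hk, star_mul]
  simp only [Nat.succPNat_coe, mul_assoc]

lemma wordProd_mul_star_mem_level (ht : VacuumRel t)
    {L : ℕ} {μ ν : List ℕ+} (hμ : ∀ i ∈ μ, (i : ℕ) ≤ n)
    (hν : ∀ i ∈ ν, (i : ℕ) ≤ n) (hμL : μ.length ≤ L) (hνL : ν.length ≤ L) :
    wordProd t n μ * star (wordProd t n ν) ∈ level t n L := by
  -- Induction on the gap between L and the longer word: each expansion lowers it by one, and at gap
  -- zero the product is already a monomial of level L.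
  obtain ⟨d, hd⟩ : ∃ d, max μ.length ν.length + d = L := ⟨L - max μ.length ν.length, by omega⟩
  induction d generalizing μ ν with
  | zero =>
    by_cases h1 : μ.IsChain (· ≥ ·)
    · by_cases h2 : ν.IsChain (· ≥ ·)
      · refine Submodule.subset_span ⟨⟨μ, h1⟩, ⟨hμ, hμL⟩, ⟨ν, h2⟩, ⟨hν, hνL⟩, ?_⟩
        rw [monomial, if_pos]
        exact hd
      · rw [wordProd_eq_zero ht.toMonotoneRel h2, star_zero, mul_zero]; exact zero_mem _
    · rw [wordProd_eq_zero ht.toMonotoneRel h1, zero_mul]; exact zero_mem _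
  | succ d ih =>
    rw [wordProd_mul_star_eq ht]
    refine add_mem (sum_mem fun k hk => ?_)
      (wordProd_mul_vacuum_mul_mem_level ht hμ hν (by omega) (by omega))
    have hk : ((k.succPNat : ℕ+) : ℕ) ≤ n := Finset.mem_range.1 hk
    refine ih ?_ ?_ ?_ ?_ ?_
    · intro i hi
      rcases List.mem_append.1 hi with hi | hi
      · exact hμ i hi
      · rw [List.mem_singleton.1 hi]; exact hk
    · intro i hi
      rcases List.mem_append.1 hi with hi | hi
      · exact hν i hi
      · rw [List.mem_singleton.1 hi]; exact hk
    all_goals simp only [List.length_append, List.length_singleton]; omega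

lemma level_mono (ht : VacuumRel t) {L M : ℕ} (h : L ≤ M) : level t n L ≤ level t n M := fun _ hx =>
  level_induction LinearMap.id
    (fun _ _ h1 h2 h3 h4 => wordProd_mul_star_mem_level ht h1 h2 (h3.trans h) (h4.trans h))
    (fun _ _ h1 h2 h3 h4 =>
      wordProd_mul_vacuum_mul_mem_level ht h1 h2 (h3.trans_le h) (h4.trans_le h)) hx

lemma initialProj_mem_level (ht : VacuumRel t) : initialProj t n ∈ level t n 0 := by
  have := wordProd_mul_star_mem_level (n := n) (L := 0) ht (μ := []) (ν := []) (by simp) (by simp)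
    le_rfl le_rfl
  rwa [wordProd_nil, star_initialProj,
    ht.toMonotoneRel.initialProj_mul_initialProj le_rfl] at this

lemma zero_gen_mul_mem_level (ht : VacuumRel t) {L : ℕ} {x : D} (hx : x ∈ level t n L) :
    t 0 * x ∈ level t n (L + 1) := by
  have h := ht.toMonotoneRel
  have hnil : t 0 * initialProj t n = initialProj t n * t 0 := by
    rw [h.mul_initialProj (Nat.zero_le n), h.initialProj_mul (Nat.zero_le n)]
  refine level_induction (LinearMap.mulLeft ℂ (t 0)) (fun μ ν h1 h2 h3 h4 => ?_)
    (fun μ ν h1 h2 h3 h4 => ?_) hx <;> rw [LinearMap.mulLeft_apply]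
  · cases μ with
    | nil =>
      have := wordProd_mul_vacuum_mul_mem_level ht (L := L + 1) h1 h2 (by omega) (by omega)
      rwa [wordProd_nil, ← hnil, mul_assoc] at this
    | cons j μ =>
      rw [wordProd_cons, ← mul_assoc, ← mul_assoc, ht.zero_gen_mul j.ne_zero, zero_mul, zero_mul]
      exact zero_mem _
  · cases μ with
    | nil =>
      have := wordProd_mul_vacuum_mul_mem_level ht (L := L + 1) h1 h2 (by omega) (by omega)
      rw [wordProd_nil, ← hnil] at *
      rwa [← mul_assoc, ← mul_assoc, ht.zero_gen_mul_self]
    | cons j μ =>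
      simp only [wordProd_cons, ← mul_assoc, ht.zero_gen_mul j.ne_zero, zero_mul]
      exact zero_mem _

lemma pos_gen_mul_mem_level (ht : VacuumRel t)
    {L : ℕ} {i : ℕ+} (hi : (i : ℕ) ≤ n) {x : D} (hx : x ∈ level t n L) :
    t i * x ∈ level t n (L + 1) := by
  refine level_induction (LinearMap.mulLeft ℂ (t i)) (fun μ ν h1 h2 h3 h4 => ?_)
    (fun μ ν h1 h2 h3 h4 => ?_) hx <;> rw [LinearMap.mulLeft_apply]
  · rw [← mul_assoc, ← wordProd_cons]
    exact wordProd_mul_star_mem_level ht (by simpa using ⟨hi, h1⟩) h2 (by simpa using h3)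
      (by omega)
  · rw [← mul_assoc, ← mul_assoc, ← wordProd_cons]
    exact wordProd_mul_vacuum_mul_mem_level ht (by simpa using ⟨hi, h1⟩) h2 (by simpa using h3)
      (by omega)

/-- Expand qᵢ and absorb the starred factors on the right: tₖ tₖ* t_ν* = tₖ (t_ν tₖ)*. The t₀ term
is already in normal form. -/
lemma initialProj_mul_star_wordProd_mem_level (ht : VacuumRel t)
    {L i : ℕ} (hi : i ≤ n) {ν : List ℕ+}
    (hν : ∀ i ∈ ν, (i : ℕ) ≤ n) (hνL : ν.length ≤ L) :
    initialProj t i * star (wordProd t n ν) ∈ level t n (L + 1) := by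
  have h := ht.toMonotoneRel
  rw [ht.initialProj_eq, add_mul, Finset.sum_mul]
  refine add_mem (sum_mem fun k hk => ?_) ?_
  · have hk : ((k.succPNat : ℕ+) : ℕ) ≤ n := (Finset.mem_range.1 hk).trans_le hi
    have hmem := wordProd_mul_star_mem_level ht (L := L + 1) (μ := [k.succPNat])
      (ν := ν ++ [k.succPNat]) (by simpa using hk)
      (by
        intro i hi
        rcases List.mem_append.1 hi with hi | hi
        · exact hν i hi
        · rw [List.mem_singleton.1 hi]; exact hk)
      (by simp) (by simpa using hνL)
    rw [← wordProd_mul_gen h ν hk, wordProd_cons, wordProd_nil, h.mul_initialProj hk, star_mul,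
      ← mul_assoc] at hmem
    exact hmem
  · have := wordProd_mul_vacuum_mul_mem_level ht (L := L + 1) (μ := []) (by simp) hν (by simp)
      (by omega)
    rwa [wordProd_nil, h.initialProj_mul (Nat.zero_le n)] at this

/-- The factor tᵢ* either joins ν when μ is empty, or meets the first letter of μ. A different
letter gives 0. An equal letter gives qᵢ, which fixes or kills the next letter, and must be expanded
only if no letter is left and no t₀ follows. -/
lemma star_pos_gen_mul_mem_level (ht : VacuumRel t) {L : ℕ} {i : ℕ+} (hi : (i : ℕ) ≤ n) {x : D}
    (hx : x ∈ level t n L) : star (t i) * x ∈ level t n (L + 1) := by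
  have h := ht.toMonotoneRel
  have hself : star (t i) * t i = initialProj t i := rfl
  refine level_induction (LinearMap.mulLeft ℂ (star (t i))) (fun μ ν h1 h2 h3 h4 => ?_)
    (fun μ ν h1 h2 h3 h4 => ?_) hx <;> rw [LinearMap.mulLeft_apply]
  · rcases μ with _ | ⟨j, μ⟩
    · have hmem := wordProd_mul_star_mem_level ht (L := L + 1) (μ := []) (ν := ν ++ [i]) (by simp)
        (by
          intro k hk
          rcases List.mem_append.1 hk with hk | hk
          · exact h2 k hk
          · rw [List.mem_singleton.1 hk]; exact hi)
        (by simp) (by simpa using h4)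
      rw [wordProd_nil, initialProj_mul_star_wordProd h] at hmem ⊢
      rwa [← wordProd_mul_gen h ν hi, star_mul] at hmem
    · rw [wordProd_cons, ← mul_assoc, ← mul_assoc]
      by_cases hij : i = j
      · subst hij
        rw [hself]
        rcases μ with _ | ⟨k, μ⟩
        · rw [wordProd_nil, h.initialProj_mul_initialProj hi]
          exact initialProj_mul_star_wordProd_mem_level ht hi h2 h4
        · rw [wordProd_cons, ← mul_assoc]
          rcases le_or_gt (k : ℕ) i with hk | hk
          · rw [h.initialProj_mul hk, ← wordProd_cons]
            refine wordProd_mul_star_mem_level ht (fun a ha => h1 a (List.mem_cons_of_mem _ ha)) h2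
              ?_ (by omega)
            simp only [List.length_cons] at h3 ⊢
            omega
          · rw [h.initialProj_mul_of_lt hk, zero_mul, zero_mul]; exact zero_mem _
      · rw [h.orthogonal i j (by exact_mod_cast hij), zero_mul, zero_mul]; exact zero_mem _
  · rcases μ with _ | ⟨j, μ⟩
    · rw [wordProd_nil, h.initialProj_mul (Nat.zero_le n), ← mul_assoc,
        ht.star_mul_zero_gen i.ne_zero, zero_mul]
      exact zero_mem _
    · rw [wordProd_cons, ← mul_assoc, ← mul_assoc, ← mul_assoc]
      by_cases hij : i = j
      · subst hij
        rw [hself]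
        rcases μ with _ | ⟨k, μ⟩
        · have := wordProd_mul_vacuum_mul_mem_level ht (L := L + 1) (μ := []) (by simp) h2
            (by simp) (by omega)
          rw [wordProd_nil, h.initialProj_mul (Nat.zero_le n)] at this
          rwa [wordProd_nil, mul_assoc (initialProj t i), h.initialProj_mul (Nat.zero_le n),
            h.initialProj_mul (Nat.zero_le _)]
        · rw [wordProd_cons, ← mul_assoc]
          rcases le_or_gt (k : ℕ) i with hk | hk
          · rw [h.initialProj_mul hk, ← wordProd_cons]
            refine wordProd_mul_vacuum_mul_mem_level ht
              (fun a ha => h1 a (List.mem_cons_of_mem _ ha)) h2 ?_ (by omega)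
            simp only [List.length_cons] at h3 ⊢
            omega
          · rw [h.initialProj_mul_of_lt hk, zero_mul, zero_mul, zero_mul]; exact zero_mem _
      · rw [h.orthogonal i j (by exact_mod_cast hij), zero_mul, zero_mul, zero_mul]
        exact zero_mem _

end Level

/-- Left multiplication by `a` raises the level by at most `d`. -/
def DegreeLE (t : ℕ → D) (n d : ℕ) (a : D) : Prop :=
  ∀ L, ∀ x ∈ level t n L, a * x ∈ level t n (L + d)

/-! ### Degrees of ⋆-polynomials with respect to the levels -/

section Degree

variable {n : ℕ}

lemma DegreeLE.mono (ht : VacuumRel t) {d d' : ℕ} (h : d ≤ d') {a : D} (ha : DegreeLE t n d a) :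
    DegreeLE t n d' a := fun L x hx => level_mono ht (by omega) (ha L x hx)

lemma DegreeLE.mul {d d' : ℕ} {a b : D} (ha : DegreeLE t n d a) (hb : DegreeLE t n d' b) :
    DegreeLE t n (d + d') (a * b) := fun L x hx => by
  rw [mul_assoc, add_comm d, ← add_assoc]
  exact ha _ _ (hb L x hx)

lemma DegreeLE.add {d : ℕ} {a b : D} (ha : DegreeLE t n d a) (hb : DegreeLE t n d b) :
    DegreeLE t n d (a + b) := fun L x hx => by
  rw [add_mul]; exact add_mem (ha L x hx) (hb L x hx)

lemma DegreeLE.smul {d : ℕ} {a : D} (c : ℂ) (ha : DegreeLE t n d a) :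
    DegreeLE t n d (c • a) := fun L x hx => by
  rw [smul_mul_assoc]; exact Submodule.smul_mem _ c (ha L x hx)

lemma DegreeLE.zero (d : ℕ) : DegreeLE t n d 0 := fun L x _ => by
  rw [zero_mul]; exact zero_mem _

lemma degreeLE_gen (ht : VacuumRel t) {i : ℕ} (hi : i ≤ n) :
    DegreeLE t n 1 (t i) ∧ DegreeLE t n 1 (star (t i)) := by
  rcases Nat.eq_zero_or_pos i with rfl | h
  · rw [ht.star_zero_gen]
    exact ⟨fun L x hx => zero_gen_mul_mem_level ht hx, fun L x hx => zero_gen_mul_mem_level ht hx⟩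
  · lift i to ℕ+ using h
    exact ⟨fun L x hx => pos_gen_mul_mem_level ht hi hx,
      fun L x hx => star_pos_gen_mul_mem_level ht hi hx⟩

/-- The bound for the adjoint is carried along because a bound on left multiplication by a says
nothing directly about a*, and the induction passes through adjoints. -/
lemma exists_degreeLE (ht : VacuumRel t) {a : D}
    (ha : a ∈ NonUnitalStarAlgebra.adjoin ℂ (t '' Set.Iic n)) :
    ∃ d, DegreeLE t n d a ∧ DegreeLE t n d (star a) := by
  induction ha using NonUnitalStarAlgebra.adjoin_induction with
  | mem x hx =>
    obtain ⟨i, hi, rfl⟩ := hx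
    exact ⟨1, degreeLE_gen ht hi⟩
  | add x y _ _ ihx ihy =>
    obtain ⟨d, h1, h2⟩ := ihx
    obtain ⟨e, h3, h4⟩ := ihy
    refine ⟨max d e, (h1.mono ht (le_max_left _ _)).add (h3.mono ht (le_max_right _ _)), ?_⟩
    rw [star_add]
    exact (h2.mono ht (le_max_left _ _)).add (h4.mono ht (le_max_right _ _))
  | zero => exact ⟨0, .zero 0, by rw [star_zero]; exact .zero 0⟩
  | mul x y _ _ ihx ihy =>
    obtain ⟨d, h1, h2⟩ := ihx
    obtain ⟨e, h3, h4⟩ := ihy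
    refine ⟨d + e, h1.mul h3, ?_⟩
    rw [star_mul, add_comm]
    exact h4.mul h2
  | smul c x _ ih =>
    obtain ⟨d, h1, h2⟩ := ih
    exact ⟨d, h1.smul c, by rw [star_smul]; exact h2.smul _⟩
  | star x _ ih =>
    obtain ⟨d, h1, h2⟩ := ih
    exact ⟨d, h2, by rwa [star_star]⟩

lemma initialProj_mul_of_mem_adjoin (ht : MonotoneRel t) {a : D}
    (ha : a ∈ NonUnitalStarAlgebra.adjoin ℂ (t '' Set.Iic n)) :
    initialProj t n * a = a ∧ a * initialProj t n = a := by
  induction ha using NonUnitalStarAlgebra.adjoin_induction with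
  | mem x hx =>
    obtain ⟨i, hi, rfl⟩ := hx
    exact ⟨ht.initialProj_mul hi, ht.mul_initialProj hi⟩
  | add x y _ _ ihx ihy => rw [mul_add, add_mul, ihx.1, ihx.2, ihy.1, ihy.2]; exact ⟨rfl, rfl⟩
  | zero => simp
  | mul x y _ _ ihx ihy => exact ⟨by rw [← mul_assoc, ihx.1], by rw [mul_assoc, ihy.2]⟩
  | smul c x _ ih => exact ⟨by rw [mul_smul_comm, ih.1], by rw [smul_mul_assoc, ih.2]⟩
  | star x _ ih =>
    exact ⟨by rw [← star_initialProj, ← star_mul, ih.2],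
      by rw [← star_initialProj, ← star_mul, ih.1]⟩

end Degree

end Relations

/-! ### Comparison of norms with the Fock representation -/

/-- A weakly decreasing word is the sorted list of its letters, hence determined by their
multiplicities. This gives growth polynomial in L for fixed n. -/
lemma boundedWords_encode_injOn (n L : ℕ) :
    Set.InjOn (fun (w : Word) (i : Fin n) =>
      (Fin.ofNat (L + 1) (w.1.count (i : ℕ).succPNat))) (boundedWords n L) := by
  intro w hw w' hw' h
  have key : ∀ j : ℕ+, w.1.count j = w'.1.count j := by
    intro j
    by_cases hj : (j : ℕ) ≤ n
    · have hlt : j.natPred < n := by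
        have := PNat.natPred_add_one j
        omega
      have h1 := congrArg Fin.val (congrFun h ⟨j.natPred, hlt⟩)
      -- `Fin.ofNat` reduces modulo L + 1, which is harmless since a multiplicity is at most the
      -- length, hence at most L.
      simp only [Fin.ofNat, PNat.succPNat_natPred] at h1
      have h2 := (List.count_le_length (a := j) (l := w.1)).trans hw.2
      have h3 := (List.count_le_length (a := j) (l := w'.1)).trans hw'.2
      rwa [Nat.mod_eq_of_lt (by omega), Nat.mod_eq_of_lt (by omega)] at h1
    · rw [List.count_eq_zero_of_not_mem fun hm => hj (hw.1 j hm),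
        List.count_eq_zero_of_not_mem fun hm => hj (hw'.1 j hm)]
  refine Subtype.ext ((List.perm_iff_count.2 key).eq_of_pairwise ?_ w.2.pairwise w'.2.pairwise)
  exact fun a b _ _ hab hba => le_antisymm hba hab

lemma boundedWords_finite (n L : ℕ) : (boundedWords n L).Finite :=
  Set.Finite.of_injOn (Set.mapsTo_univ _ _) (boundedWords_encode_injOn n L) Set.finite_univ

lemma card_boundedWords_le (n L : ℕ) :
    (boundedWords_finite n L).toFinset.card ≤ (L + 1) ^ n := by
  have := Finset.card_le_card_of_injOn (s := (boundedWords_finite n L).toFinset)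
    (t := (Finset.univ : Finset (Fin n → Fin (L + 1)))) _ (fun _ _ => Finset.mem_univ _)
    (by simpa using boundedWords_encode_injOn n L)
  simpa using this

/-! ### Matrix entries of the monomials in Fock space -/

lemma fockGen_coe (i : ℕ+) : fockGen i = creation i := by
  have : (i : ℕ) = i.natPred + 1 := (PNat.natPred_add_one i).symm
  rw [this, fockGen_succ, PNat.succPNat_natPred]

lemma initialProj_fockGen_basisVec {n : ℕ} {γ : Word} (hγ : ∀ i ∈ γ.1, (i : ℕ) ≤ n) :
    initialProj fockGen n (basisVec γ) = basisVec γ := by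
  classical
  rcases n with _ | n
  · obtain ⟨_ | ⟨j, l⟩, hl⟩ := γ
    · rw [initialProj, mul_apply_eq_comp]
      change star vacProj (vacProj vac) = vac
      rw [star_vacProj, vacProj_vac, vacProj_vac]
    · have := hγ j List.mem_cons_self
      exact absurd this (by simp)
  · rw [initialProj, fockGen_succ, star_creation, mul_apply_eq_comp, annihilation_creation, if_pos]
    intro j hj
    exact hγ j (List.mem_of_mem_head? hj)

/-- The adjoint of a product of creators strips the prefix ν. The trailing qₙ fixes the remainder
because its letters are at most n. -/
lemma star_wordProd_fockGen_append {n : ℕ} (ν σ : List ℕ+) (h : (ν ++ σ).IsChain (· ≥ ·))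
    (hσ : ∀ i ∈ σ, (i : ℕ) ≤ n) :
    star (wordProd fockGen n ν) (basisVec ⟨ν ++ σ, h⟩) =
      basisVec ⟨σ, h.right_of_append⟩ := by
  induction ν with
  | nil =>
    rw [wordProd_nil, star_initialProj]
    exact initialProj_fockGen_basisVec hσ
  | cons i ν ih =>
    rw [wordProd_cons, star_mul, mul_apply_eq_comp, fockGen_coe, star_creation]
    have := annihilation_cons i i (ν ++ σ) h
    rw [if_pos rfl] at this
    exact (congrArg _ this).trans (ih h.tail)

lemma star_wordProd_fockGen_of_not_prefix {n : ℕ} (ν : List ℕ+) (β : Word) (h : ¬ ν <+: β.1) :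
    star (wordProd fockGen n ν) (basisVec β) = 0 := by
  induction ν generalizing β with
  | nil => exact absurd List.nil_prefix h
  | cons i ν ih =>
    rw [wordProd_cons, star_mul, mul_apply_eq_comp, fockGen_coe, star_creation]
    obtain ⟨_ | ⟨j, l⟩, hl⟩ := β
    · exact (congrArg _ (annihilation_nil i)).trans (map_zero _)
    · rw [annihilation_cons]
      split_ifs with hj
      · subst hj
        refine ih _ fun h' => h ?_
        simpa using h'
      · exact map_zero _

-- Writing α = μσ and β = ντ, the entry is ⟨e_σ, e_τ⟩ or ⟨e_σ, P_Ω e_τ⟩, and in both cases it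
-- survives only for empty σ and τ: either P_Ω forces this, or the longer of μ, ν leaves no room for
-- a common remainder.
open Classical in
lemma monomial_fockGen_entry {n L : ℕ} {μ ν α β : Word} (hα : α ∈ boundedWords n L)
    (hβ : β ∈ boundedWords n L) :
    monomial fockGen n L μ ν (basisVec β) α = if α = μ ∧ β = ν then 1 else 0 := by
  have hentry : ∀ (S T : Fock →L[ℂ] Fock), (star S * T) (basisVec β) α =
      inner ℂ (S (basisVec α)) (T (basisVec β)) := fun S T => by
    rw [← inner_basisVec_left, mul_apply_eq_comp, ContinuousLinearMap.star_eq_adjoint,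
      ContinuousLinearMap.adjoint_inner_right]
  have hprod : monomial fockGen n L μ ν = star (star (wordProd fockGen n μ.1)) *
      ((if max μ.1.length ν.1.length = L then 1 else vacProj) *
        star (wordProd fockGen n ν.1)) := by
    rw [monomial, star_star]
    split_ifs
    · rw [one_mul]
    · rw [mul_assoc]; rfl
  rw [hprod, hentry, mul_apply_eq_comp]
  by_cases h1 : μ.1 <+: α.1
  swap
  · rw [star_wordProd_fockGen_of_not_prefix _ _ h1, inner_zero_left, if_neg]
    rintro ⟨rfl, _⟩; exact h1 List.prefix_rfl
  by_cases h2 : ν.1 <+: β.1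
  swap
  · rw [star_wordProd_fockGen_of_not_prefix _ _ h2, map_zero, inner_zero_right, if_neg]
    rintro ⟨_, rfl⟩; exact h2 List.prefix_rfl
  obtain ⟨α, hαc⟩ := α
  obtain ⟨β, hβc⟩ := β
  obtain ⟨μ, hμ⟩ := μ
  obtain ⟨ν, hν⟩ := ν
  obtain ⟨σ, rfl⟩ := h1
  obtain ⟨τ, rfl⟩ := h2
  have hα1 := hα.2
  have hβ1 := hβ.2
  simp only [List.length_append] at hα1 hβ1
  rw [star_wordProd_fockGen_append μ σ hαc fun i hi => hα.1 i (List.mem_append_right _ hi),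
    star_wordProd_fockGen_append ν τ hβc fun i hi => hβ.1 i (List.mem_append_right _ hi),
    inner_basisVec_left]
  simp only [Subtype.mk.injEq, List.append_right_eq_self]
  split_ifs with hL hnil hnil
  · obtain ⟨rfl, rfl⟩ := hnil
    exact basisVec_self _
  · refine basisVec_ne fun h => hnil ?_
    have h := congrArg Subtype.val h
    dsimp only at h
    subst h
    -- One of μ, ν has length L, so its remainder is empty, and the two remainders agree.
    have : σ.length = 0 := by omega
    simpa using this
  · obtain ⟨rfl, rfl⟩ := hnil
    exact (congrArg (fun f : Fock => f _) vacProj_vac).trans (basisVec_self _)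
  · rcases τ with _ | ⟨j, τ⟩
    · refine (congrArg (fun f : Fock => f _) vacProj_vac).trans (basisVec_ne fun h => hnil ?_)
      exact ⟨congrArg Subtype.val h, rfl⟩
    · rw [vacProj_cons]; rfl

/-! ### A norm bound polynomial in the level -/

section Comparison

variable {D : Type v} [NonUnitalCStarAlgebra D] {t : ℕ → D}

lemma norm_monomial_le (ht : MonotoneRel t) (n L : ℕ) (μ ν : Word) :
    ‖monomial t n L μ ν‖ ≤ 1 := by
  have h1 := norm_wordProd_le (n := n) ht μ.1
  have h2 := norm_wordProd_le (n := n) ht ν.1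
  rw [← norm_star] at h2
  rw [monomial]
  split_ifs
  · exact (norm_mul_le _ _).trans (mul_le_one₀ h1 (norm_nonneg _) h2)
  · refine (norm_mul_le _ _).trans (mul_le_one₀ ?_ (norm_nonneg _) h2)
    exact (norm_mul_le _ _).trans (mul_le_one₀ h1 (norm_nonneg _) (ht.norm_gen_le 0))

variable {π : D →⋆ₙₐ[ℂ] (Fock →L[ℂ] Fock)}

lemma map_wordProd (hπ : ∀ i, π (t i) = fockGen i)
    (n : ℕ) (l : List ℕ+) : π (wordProd t n l) = wordProd fockGen n l := by
  induction l with
  | nil => rw [wordProd_nil, wordProd_nil, initialProj, initialProj, map_mul, map_star, hπ]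
  | cons i l ih => rw [wordProd_cons, wordProd_cons, map_mul, ih, hπ]

lemma map_monomial (hπ : ∀ i, π (t i) = fockGen i) (n L : ℕ) (μ ν : Word) :
    π (monomial t n L μ ν) = monomial fockGen n L μ ν := by
  rw [monomial, monomial]
  split_ifs <;> simp only [map_mul, map_star, map_wordProd hπ, hπ]

/-- Elements of level `L` are recovered from their matrix entries in the Fock representation. -/
lemma eq_sum_entry_smul_monomial (hπ : ∀ i, π (t i) = fockGen i)
    {n L : ℕ} {x : D} (hx : x ∈ level t n L) :
    x = ∑ p ∈ (boundedWords_finite n L).toFinset ×ˢ (boundedWords_finite n L).toFinset,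
      (π x (basisVec p.2) p.1 : ℂ) • monomial t n L p.1 p.2 := by
  classical
  induction hx using Submodule.span_induction with
  | mem x hx =>
    obtain ⟨μ, hμ, ν, hν, rfl⟩ := hx
    rw [Finset.sum_eq_single (μ, ν)]
    · rw [map_monomial hπ, monomial_fockGen_entry hμ hν, if_pos ⟨rfl, rfl⟩, one_smul]
    · rintro ⟨α, β⟩ hp hne
      rw [Finset.mem_product, Set.Finite.mem_toFinset, Set.Finite.mem_toFinset] at hp
      rw [map_monomial hπ, monomial_fockGen_entry hp.1 hp.2, if_neg, zero_smul]
      rintro ⟨rfl, rfl⟩; exact hne rfl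
    · intro h
      rw [Finset.mem_product, Set.Finite.mem_toFinset, Set.Finite.mem_toFinset] at h
      exact absurd ⟨hμ, hν⟩ h
  | zero =>
    rw [map_zero]
    exact (Finset.sum_eq_zero fun p _ => zero_smul ℂ _).symm
  | add x y _ _ hx hy =>
    conv_lhs => rw [hx, hy]
    rw [← Finset.sum_add_distrib]
    refine Finset.sum_congr rfl fun p _ => ?_
    rw [map_add, ← add_smul]; rfl
  | smul c x _ hx =>
    conv_lhs => rw [hx]
    rw [Finset.smul_sum]
    refine Finset.sum_congr rfl fun p _ => ?_
    rw [map_smul, smul_smul]; rfl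

/-- Sum over pairs of words: monomials are contractions and entries are at most ‖π(x)‖. The exponent
n + n counts the pairs. -/
lemma norm_le_of_mem_level (hπ : ∀ i, π (t i) = fockGen i)
    (ht : MonotoneRel t) {n L : ℕ} {x : D} (hx : x ∈ level t n L) :
    ‖x‖ ≤ ((L : ℝ) + 1) ^ (n + n) * ‖π x‖ := by
  conv_lhs => rw [eq_sum_entry_smul_monomial hπ hx]
  refine (norm_sum_le_of_le _ (n := fun _ => ‖π x‖) fun p _ => ?_).trans ?_
  · rw [norm_smul]
    exact (mul_le_mul (norm_entry_le _ _ _) (norm_monomial_le ht _ _ _ _) (norm_nonneg _)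
      (norm_nonneg _)).trans_eq (mul_one _)
  · rw [Finset.sum_const, Finset.card_product, nsmul_eq_mul, pow_add]
    have h : ((boundedWords_finite n L).toFinset.card : ℝ) ≤ ((L : ℝ) + 1) ^ n := by
      exact_mod_cast card_boundedWords_le n L
    push_cast
    gcongr

end Comparison

/-- If a > b > 0, then (a/b)^k outgrows every polynomial in k, in particular along k = 2ʲ. -/
lemma le_of_pow_le_polynomial_mul_pow {a b : ℝ} (hb : 0 ≤ b) (d m : ℕ)
    (h : ∀ j : ℕ, a ^ 2 ^ j ≤ ((d * 2 ^ j : ℕ) + 1 : ℝ) ^ m * b ^ 2 ^ j) : a ≤ b := by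
  by_contra! hlt
  rcases hb.eq_or_lt with rfl | hb
  · have := h 0
    simp only [pow_zero, pow_one, mul_zero] at this
    linarith
  have hr : 1 < a / b := (one_lt_div hb).2 hlt
  have hlim := (tendsto_pow_const_div_const_pow_of_one_lt m hr).const_mul (((d : ℝ) + 1) ^ m)
  rw [mul_zero] at hlim
  have hlim2 := hlim.comp (tendsto_pow_atTop_atTop_of_one_lt (α := ℕ) one_lt_two)
  obtain ⟨j, hj⟩ := (hlim2.eventually_lt_const one_pos).exists
  rw [Function.comp_apply, ← mul_div_assoc, ← mul_pow, div_lt_one (by positivity), div_pow,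
    lt_div_iff₀ (by positivity)] at hj
  -- This uses d·2ʲ + 1 ≤ (d + 1)·2ʲ, the source of the constant (d + 1)ᵐ in the limit.
  refine absurd (h j) (not_le.2 (lt_of_le_of_lt ?_ hj))
  gcongr
  push_cast
  have : (1 : ℝ) ≤ 2 ^ j := one_le_pow₀ one_le_two
  linarith

lemma exists_mem_adjoin_image {D : Type v} [NonUnitalCStarAlgebra D] {t : ℕ → D} {x : D}
    (hx : x ∈ NonUnitalStarAlgebra.adjoin ℂ (Set.range t)) :
    ∃ n, x ∈ NonUnitalStarAlgebra.adjoin ℂ (t '' Set.Iic n) := by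
  have hmono : ∀ {m n : ℕ}, m ≤ n → NonUnitalStarAlgebra.adjoin ℂ (t '' Set.Iic m) ≤
      NonUnitalStarAlgebra.adjoin ℂ (t '' Set.Iic n) := fun h =>
    NonUnitalStarAlgebra.adjoin_mono (Set.image_mono (Set.Iic_subset_Iic.2 h))
  induction hx using NonUnitalStarAlgebra.adjoin_induction with
  | mem x hx =>
    obtain ⟨i, rfl⟩ := hx
    exact ⟨i, NonUnitalStarAlgebra.subset_adjoin ℂ _ ⟨i, Set.mem_Iic.2 le_rfl, rfl⟩⟩
  | add x y _ _ ihx ihy =>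
    obtain ⟨m, hm⟩ := ihx
    obtain ⟨n, hn⟩ := ihy
    exact ⟨max m n, add_mem (hmono (le_max_left _ _) hm) (hmono (le_max_right _ _) hn)⟩
  | zero => exact ⟨0, zero_mem _⟩
  | mul x y _ _ ihx ihy =>
    obtain ⟨m, hm⟩ := ihx
    obtain ⟨n, hn⟩ := ihy
    exact ⟨max m n, mul_mem (hmono (le_max_left _ _) hm) (hmono (le_max_right _ _) hn)⟩
  | smul c x _ ih =>
    obtain ⟨n, hn⟩ := ih
    exact ⟨n, SMulMemClass.smul_mem c hn⟩
  | star x _ ih =>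
    obtain ⟨n, hn⟩ := ih
    exact ⟨n, star_mem hn⟩

/-! ### From the polynomial bound to an isometry -/

section Comparison

variable {D : Type v} [NonUnitalCStarAlgebra D] {t : ℕ → D}
  {π : D →⋆ₙₐ[ℂ] (Fock →L[ℂ] Fock)}

/-- Repeated squaring of a self-adjoint y squares both ‖y‖ and ‖π(y)‖ exactly while only doubling
the degree, so the polynomial loss is removed by taking roots. -/
lemma norm_le_norm_map_of_isSelfAdjoint (ht : VacuumRel t) (hπ : ∀ i, π (t i) = fockGen i)
    {n d : ℕ} {y : D} (hy : IsSelfAdjoint y)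
    (hd : DegreeLE t n d y) (hu : y * initialProj t n = y) : ‖y‖ ≤ ‖π y‖ := by
  refine le_of_pow_le_polynomial_mul_pow (norm_nonneg _) d (n + n) fun j => ?_
  obtain ⟨z, hz, hzd, hzu, hzn, hzπ⟩ : ∃ z : D, IsSelfAdjoint z ∧ DegreeLE t n (d * 2 ^ j) z ∧
      z * initialProj t n = z ∧ ‖z‖ = ‖y‖ ^ 2 ^ j ∧ ‖π z‖ = ‖π y‖ ^ 2 ^ j := by
    induction j with
    | zero => exact ⟨y, hy, by simpa using hd, hu, by simp, by simp⟩
    | succ j ih =>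
      obtain ⟨z, hz, hzd, hzu, hzn, hzπ⟩ := ih
      refine ⟨z * z, ?_, ?_, by rw [mul_assoc, hzu], ?_, ?_⟩
      · rw [IsSelfAdjoint, star_mul, hz.star_eq]
      · have := hzd.mul hzd
        rwa [← mul_two, mul_assoc, ← pow_succ] at this
      · rw [hz.norm_mul_self, hzn, ← pow_mul, ← pow_succ]
      · rw [map_mul, (hz.map π).norm_mul_self, hzπ, ← pow_mul, ← pow_succ]
  rw [← hzn, ← hzπ]
  -- The degree bound becomes membership in a level on writing z = z qₙ with qₙ in level 0.
  refine norm_le_of_mem_level hπ ht.toMonotoneRel ?_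
  have := hzd 0 _ (initialProj_mem_level ht)
  rwa [hzu, zero_add] at this

lemma norm_le_norm_map_of_mem_adjoin_image (ht : VacuumRel t) (hπ : ∀ i, π (t i) = fockGen i)
    {n : ℕ} {x : D}
    (hx : x ∈ NonUnitalStarAlgebra.adjoin ℂ (t '' Set.Iic n)) : ‖x‖ ≤ ‖π x‖ := by
  obtain ⟨d, h1, h2⟩ := exists_degreeLE ht hx
  have hu := (initialProj_mul_of_mem_adjoin ht.toMonotoneRel hx).2
  have := norm_le_norm_map_of_isSelfAdjoint ht hπ (IsSelfAdjoint.star_mul_self x) (h2.mul h1)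
    (by rw [mul_assoc, hu])
  rw [map_mul, map_star, CStarRing.norm_star_mul_self] at this
  exact (mul_self_le_mul_self_iff (norm_nonneg _) (norm_nonneg _)).2
    (this.trans_eq (CStarRing.norm_star_mul_self (x := π x)))

/-- The Fock representation of an algebra generated by a family satisfying `VacuumRel` is
isometric. -/
theorem norm_map_eq (ht : VacuumRel t) (hπ : ∀ i, π (t i) = fockGen i)
    (hdense : Dense (NonUnitalStarAlgebra.adjoin ℂ (Set.range t) : Set D)) (x : D) :
    ‖π x‖ = ‖x‖ := by
  have hcont : Continuous π := AddMonoidHomClass.continuous_of_bound π 1 fun x => by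
    simpa using NonUnitalStarAlgHom.norm_apply_le π x
  refine le_antisymm (NonUnitalStarAlgHom.norm_apply_le π x) ?_
  refine hdense.induction (P := fun x => ‖x‖ ≤ ‖π x‖) (fun x hx => ?_)
    (isClosed_le continuous_norm (continuous_norm.comp hcont)) x
  obtain ⟨n, hn⟩ := exists_mem_adjoin_image hx
  exact norm_le_norm_map_of_mem_adjoin_image ht hπ hn

end Comparison

/-! ### The isomorphisms -/

lemma creation_mem_weaklyMonotoneAlg (i : ℕ+) : creation i ∈ weaklyMonotoneAlg :=
  NonUnitalStarSubalgebra.le_topologicalClosure _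
    (NonUnitalStarAlgebra.subset_adjoin ℂ _ (Or.inr ⟨i, rfl⟩))

lemma fockGen_mem_weaklyMonotoneAlg : ∀ i, fockGen i ∈ weaklyMonotoneAlg
  | 0 => by
    have h := fockGen_rel.initialProj_eq 1
    -- The relation for i = 1 exhibits the vacuum projection as P_Ω = A₁A₁† − A₁†A₁.
    rw [Finset.sum_range_one, ← sub_eq_iff_eq_add'] at h
    rw [← h, initialProj]
    have hc : fockGen 1 ∈ weaklyMonotoneAlg := creation_mem_weaklyMonotoneAlg _
    exact sub_mem (mul_mem (star_mem hc) hc) (mul_mem hc (star_mem hc))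
  | n + 1 => creation_mem_weaklyMonotoneAlg _

/-- A C⋆-algebra generated by a family satisfying `VacuumRel` on which the Fock representation
exists is isomorphic to the weakly monotone C⋆-algebra. -/
theorem exists_starAlgEquiv {D : Type v} [NonUnitalCStarAlgebra D] {t : ℕ → D} (ht : VacuumRel t)
    {π : D →⋆ₙₐ[ℂ] (Fock →L[ℂ] Fock)} (hπ : ∀ i, π (t i) = fockGen i)
    (hdense : Dense (NonUnitalStarAlgebra.adjoin ℂ (Set.range t) : Set D)) :
    ∃ Φ : D ≃⋆ₐ[ℂ] weaklyMonotoneAlg, Isometry Φ ∧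
      ∀ x, (Φ x : Fock →L[ℂ] Fock) = π x := by
  have hiso : Isometry π := AddMonoidHomClass.isometry_of_norm π (norm_map_eq ht hπ hdense)
  have hmem : ∀ x, π x ∈ weaklyMonotoneAlg := by
    refine fun x => hdense.induction (P := fun x => π x ∈ weaklyMonotoneAlg) (fun x hx => ?_)
      ((NonUnitalStarSubalgebra.isClosed_topologicalClosure _).preimage hiso.continuous) x
    have hle : NonUnitalStarAlgebra.adjoin ℂ (Set.range t) ≤ weaklyMonotoneAlg.comap π := by
      refine NonUnitalStarAlgebra.adjoin_le ?_
      rintro _ ⟨i, rfl⟩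
      change π (t i) ∈ weaklyMonotoneAlg
      rw [hπ]
      exact fockGen_mem_weaklyMonotoneAlg i
    exact hle hx
  have hrange : weaklyMonotoneAlg ≤ NonUnitalStarAlgHom.range π := by
    have hcr : ∀ i, creation i ∈ NonUnitalStarAlgHom.range π := fun i =>
      ⟨t i, (hπ i).trans (fockGen_coe i)⟩
    refine NonUnitalStarSubalgebra.topologicalClosure_minimal _
      (NonUnitalStarAlgebra.adjoin_le ?_) ?_
    · rintro _ (⟨i, rfl⟩ | ⟨i, rfl⟩)
      · rw [← star_creation]; exact star_mem (hcr i)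
      · exact hcr i
    -- An isometric image of a complete space is closed, so containing the generators suffices.
    · have := hiso.isClosedEmbedding.isClosed_range
      rwa [NonUnitalStarAlgHom.coe_range]
  let f : D →⋆ₙₐ[ℂ] weaklyMonotoneAlg := NonUnitalStarAlgHom.codRestrict π _ hmem
  have hf : ∀ x, (f x : Fock →L[ℂ] Fock) = π x := fun _ => rfl
  have hbij : Function.Bijective f := by
    refine ⟨fun x y h => hiso.injective ?_, fun y => ?_⟩
    · rw [← hf, ← hf, h]
    · obtain ⟨x, hx⟩ := hrange y.2
      exact ⟨x, Subtype.ext hx⟩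
  refine ⟨StarAlgEquiv.ofBijective f hbij, fun x y => ?_, fun x => rfl⟩
  exact hiso x y

/-- The Fock representation of a universal C⋆-algebra whose relations hold for the Fock
generators. The index type `PUnit` adjusts the universe. -/
theorem exists_fockRep (P : ∀ (B : Type u) [NonUnitalCStarAlgebra B], (ℕ → B) → Prop)
    (hP : ∀ (B : Type u) [NonUnitalCStarAlgebra B] (t : ℕ → B), VacuumRel t → P B t) :
    ∃ π : UniversalCStar P →⋆ₙₐ[ℂ] (Fock →L[ℂ] Fock), ∀ i, π (universalGen P i) = fockGen i := by
  let A : Type u := lp (fun _ : PUnit.{u + 1} => Fock →L[ℂ] Fock) ∞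
  let ev : A →⋆ₙₐ[ℂ] (Fock →L[ℂ] Fock) :=
    { toFun := fun x => x.1 PUnit.unit
      map_smul' := fun _ _ => rfl
      map_zero' := rfl
      map_add' := fun _ _ => rfl
      map_mul' := fun _ _ => rfl
      map_star' := fun _ => rfl }
  have hev : Function.Injective ev := fun x y h => Subtype.ext (funext fun _ => h)
  let t : ℕ → A := fun i => ⟨fun _ => fockGen i, memℓp_infty ⟨‖fockGen i‖, by
    rintro _ ⟨_, rfl⟩; exact le_rfl⟩⟩
  have hevt : ∀ i, ev (t i) = fockGen i := fun _ => rfl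
  have ht : VacuumRel t :=
    { partialIsometry := fun i => hev (by
        simp only [map_mul, map_star, hevt]; exact fockGen_rel.partialIsometry i)
      orthogonal := fun i j hij => hev (by
        simp only [map_mul, map_star, hevt, map_zero]; exact fockGen_rel.orthogonal i j hij)
      sum_range := fun i => hev (by
        simp only [map_mul, map_star, hevt, map_sum]; exact fockGen_rel.sum_range i)
      vacuum := hev (by simp only [map_mul, map_star, hevt]; exact fockGen_rel.vacuum) }
  exact ⟨ev.comp (evalModel P ⟨A, t, ht.partialIsometry, hP _ _ ht⟩), fun i => rfl⟩

/-- The universal C⋆-algebra is generated by its canonical generators. -/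
theorem dense_adjoin_universalGen
    (P : ∀ (B : Type u) [NonUnitalCStarAlgebra B], (ℕ → B) → Prop) :
    Dense (NonUnitalStarAlgebra.adjoin ℂ (Set.range (universalGen P)) :
      Set (UniversalCStar P)) := by
  let ι : UniversalCStar P →⋆ₙₐ[ℂ] ModelProduct P :=
    NonUnitalStarSubalgebraClass.subtype (universalSubalgebra P)
  have hmap : (NonUnitalStarAlgebra.adjoin ℂ (Set.range (universalGen P))).map ι =
      NonUnitalStarAlgebra.adjoin ℂ (Set.range (productGen P)) := by
    rw [NonUnitalStarAlgHom.map_adjoin, ← Set.range_comp]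
    rfl
  intro x
  refine closure_subtype.2 ?_
  have hx : x.1 ∈ closure
      (NonUnitalStarAlgebra.adjoin ℂ (Set.range (productGen P)) : Set (ModelProduct P)) := x.2
  rw [← hmap] at hx
  exact hx

/-! ### Transport of the relations and the quotient by `J` -/

lemma MonotoneRel.map {A : Type u} {B : Type v} [NonUnitalCStarAlgebra A]
    [NonUnitalCStarAlgebra B] {t : ℕ → A} (ht : MonotoneRel t) (φ : A →⋆ₙₐ[ℂ] B) :
    MonotoneRel fun i => φ (t i) where
  partialIsometry i := by rw [← map_star, ← map_mul, ← map_mul, ht.partialIsometry]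
  orthogonal i j hij := by rw [← map_star, ← map_mul, ht.orthogonal i j hij, map_zero]
  sum_range i := by
    simp only [← map_star, ← map_mul, ← map_sum]
    rw [ht.sum_range]

lemma VacuumRel.map {A : Type u} {B : Type v} [NonUnitalCStarAlgebra A] [NonUnitalCStarAlgebra B]
    {t : ℕ → A} (ht : VacuumRel t) (φ : A →⋆ₙₐ[ℂ] B) : VacuumRel fun i => φ (t i) where
  toMonotoneRel := ht.toMonotoneRel.map φ
  vacuum := by rw [← map_star, ← map_mul, ← ht.vacuum]

lemma quot_rel : VacuumRel fun i => J.{u}.quotHom (OAN.s i) where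
  toMonotoneRel := OAN.rel.map J.{u}.quotHom
  vacuum := by
    rw [← map_star, ← map_mul]
    exact CStarIdeal.mk_eq_mk.2 (subset_closedIdealSpan _ rfl)

lemma dense_adjoin_quot :
    Dense (NonUnitalStarAlgebra.adjoin ℂ (Set.range fun i => J.{u}.quotHom (OAN.s i)) :
      Set J.{u}.Quot) := by
  have hcont : Continuous J.{u}.quotHom :=
    AddMonoidHomClass.continuous_of_bound J.{u}.quotHom 1 fun x => by
      simpa using NonUnitalStarAlgHom.norm_apply_le J.{u}.quotHom x
  have hsurj : Function.Surjective J.{u}.quotHom := CStarIdeal.mk_surjective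
  have h := hsurj.denseRange.dense_image hcont (dense_adjoin_universalGen.{u} _)
  have hmap : (NonUnitalStarAlgebra.adjoin ℂ (Set.range OAN.s.{u})).map J.{u}.quotHom =
      NonUnitalStarAlgebra.adjoin ℂ (Set.range fun i => J.{u}.quotHom (OAN.s i)) := by
    rw [NonUnitalStarAlgHom.map_adjoin, ← Set.range_comp]
    rfl
  rw [← hmap]
  exact h

/-- A ⋆-homomorphism on `O_{A_ℕ}` mapping the generators to a family satisfying `VacuumRel`
vanishes on `J`. -/
lemma map_eq_zero_of_mem_J {B : Type v} [NonUnitalCStarAlgebra B] (φ : OAN.{u} →⋆ₙₐ[ℂ] B)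
    (hφ : VacuumRel fun i => φ (OAN.s i)) (x : OAN.{u}) (hx : x ∈ J.{u}.carrier) : φ x = 0 := by
  have hcont : Continuous φ := AddMonoidHomClass.continuous_of_bound φ 1 fun x => by
    simpa using NonUnitalStarAlgHom.norm_apply_le φ x
  let K : Submodule ℂ OAN.{u} := LinearMap.ker (φ : OAN.{u} →ₗ[ℂ] B)
  have hK : ∀ y, y ∈ K ↔ φ y = 0 := fun _ => Iff.rfl
  have hI : IsClosedIdeal K :=
    { closed := isClosed_singleton.preimage hcont
      mul_left := fun a y hy => by rw [hK] at *; rw [map_mul, hy, mul_zero]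
      mul_right := fun a y hy => by rw [hK] at *; rw [map_mul, hy, zero_mul] }
  have hle : J.{u}.carrier ≤ K := by
    refine sInf_le ⟨hI, Set.singleton_subset_iff.2 ((hK _).2 ?_)⟩
    rw [map_sub, map_mul, map_star, ← hφ.vacuum, sub_self]
  exact hle hx

end WeaklyMonotone

end

theorem mainTheorem8 :
    -- the Fock representation induces an isometric isomorphism of `O_{A_ℕ} / J` onto `𝒲_ℕ`
    (∃ πF : WeaklyMonotone.OAN.{u} →⋆ₙₐ[ℂ] (WeaklyMonotone.Fock →L[ℂ] WeaklyMonotone.Fock),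
      (∀ i, πF (WeaklyMonotone.OAN.s i) = WeaklyMonotone.fockGen i) ∧
      ∃ Φ : WeaklyMonotone.J.{u}.Quot ≃⋆ₐ[ℂ] WeaklyMonotone.weaklyMonotoneAlg,
        Isometry Φ ∧ ∀ x, (Φ (WeaklyMonotone.J.toQuot x) :
          WeaklyMonotone.Fock →L[ℂ] WeaklyMonotone.Fock) = πF x) ∧
    -- `𝒲_ℕ` is isomorphic to the universal C⋆-algebra of the relations with `s₀ = s₀ s₀*`
    (∃ Ψ : WeaklyMonotone.VacuumOAN.{u} ≃⋆ₐ[ℂ] WeaklyMonotone.weaklyMonotoneAlg,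
      Isometry Ψ ∧ ∀ i, (Ψ (WeaklyMonotone.VacuumOAN.s i) :
        WeaklyMonotone.Fock →L[ℂ] WeaklyMonotone.Fock) = WeaklyMonotone.fockGen i) ∧
    -- that is, it has the universal property
    (∃ g : ℕ → WeaklyMonotone.weaklyMonotoneAlg,
      (∀ i, (g i : WeaklyMonotone.Fock →L[ℂ] WeaklyMonotone.Fock) = WeaklyMonotone.fockGen i) ∧
      WeaklyMonotone.VacuumRel g ∧
      ∀ (B : Type u) [NonUnitalCStarAlgebra B] (t : ℕ → B), WeaklyMonotone.VacuumRel t →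
        ∃! φ : WeaklyMonotone.weaklyMonotoneAlg →⋆ₙₐ[ℂ] B, ∀ i, φ (g i) = t i) := by

  obtain ⟨πF, hπF⟩ := WeaklyMonotone.exists_fockRep.{u}
    (fun _ _ t => WeaklyMonotone.MonotoneRel t) fun _ _ _ h => h.toMonotoneRel
  obtain ⟨πV, hπV⟩ := WeaklyMonotone.exists_fockRep.{u}
    (fun _ _ t => WeaklyMonotone.VacuumRel t) fun _ _ _ h => h
  obtain ⟨Ψ, hΨ, hΨπ⟩ := WeaklyMonotone.exists_starAlgEquiv WeaklyMonotone.VacuumOAN.rel.{u} hπV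
    (WeaklyMonotone.dense_adjoin_universalGen _)
  refine ⟨⟨πF, hπF, ?_⟩, ⟨Ψ, hΨ, fun i => (hΨπ _).trans (hπV i)⟩,
    fun i => Ψ (WeaklyMonotone.VacuumOAN.s i), fun i => (hΨπ _).trans (hπV i), ?_, ?_⟩
  · have hrel : WeaklyMonotone.VacuumRel fun i => πF (WeaklyMonotone.OAN.s i) := by
      have h : (fun i => πF (WeaklyMonotone.OAN.s i)) = WeaklyMonotone.fockGen := funext hπF
      rw [h]
      exact WeaklyMonotone.fockGen_rel
    have hJ := WeaklyMonotone.map_eq_zero_of_mem_J πF hrel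
    obtain ⟨Φ, hΦ, hΦπ⟩ := WeaklyMonotone.exists_starAlgEquiv WeaklyMonotone.quot_rel.{u}
      (π := WeaklyMonotone.CStarIdeal.quotLift πF hJ) hπF WeaklyMonotone.dense_adjoin_quot
    exact ⟨Φ, hΦ, fun x => hΦπ _⟩
  · exact WeaklyMonotone.VacuumOAN.rel.map
      (Ψ : WeaklyMonotone.VacuumOAN.{u} →⋆ₙₐ[ℂ] WeaklyMonotone.weaklyMonotoneAlg)
  · intro B _ t ht
    obtain ⟨φ, hφ, huniq⟩ := WeaklyMonotone.existsUnique_lift.{u}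
      (fun _ _ t => WeaklyMonotone.VacuumRel t) t ht.partialIsometry ht
    refine ⟨φ.comp (Ψ.symm : WeaklyMonotone.weaklyMonotoneAlg →⋆ₙₐ[ℂ]
      WeaklyMonotone.VacuumOAN.{u}), fun i => ?_, fun χ hχ => ?_⟩
    · exact (congrArg φ (Ψ.symm_apply_apply _)).trans (hφ i)
    -- Uniqueness is transported along Ψ: χ ∘ Ψ solves the lifting problem on the universal algebra.
    · have h := huniq (χ.comp
        (Ψ : WeaklyMonotone.VacuumOAN.{u} →⋆ₙₐ[ℂ] WeaklyMonotone.weaklyMonotoneAlg)) hχ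
      ext y
      rw [← h]
      exact congrArg χ (Ψ.apply_symm_apply y).symm
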